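/- **Setting.** Let $H,K$ be separable complex Hilbert spaces, $(|i\rangle)_{i\in\Lambda}$ an orthonormal basis of $K$ indexed by an at most countable set $\Lambda$, and $\mathcal A=\mathcal B(H\otimes K)$. Let $B^i_j\in\mathcal B(H)$ ($i,j\in\Lambda$) satisfy $\sum_i B_j^{i*}B_j^i=\mathbf 1$ (strongly) for every $j$, and let $\rho=\sum_i\rho_i\otimes|i\rangle\langle i|$ be a density matrix ($\rho_i\ge 0$, $\sum_i\mathrm{Tr}(\rho_i)=1$) with $\rho_i\ne0$ for all $i$. Put $$M_j^i=B_j^i\otimes|i\rangle\langle j|,\qquad A_j^i=\mathrm{Tr}(\rho_j)^{-1/2}\rho_j^{1/2}\otimes|i\rangle\langle j| .$$ Let $k\ge1$ and let $V$ be the vertex set of the rooted (semi-infinite) Cayley tree of order $k$: vertices are finite words $u$ over $\{1,\dots,k\}$, the root $o$ is the empty word, $S(u)=\{(u,1),\dots,(u,k)\}$ is the set of direct successors of $u$, and $W_n$ is the set of words of length $n$. A copy of $\mathcal A$ sits at each vertex; $a^{(u)}$ is the copy of $a\in\mathcal A$ at $u$. The transition expectation is $$\mathcal E(a)=\mathrm{Tr}_{o]}(\mathbf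 K\,a\,\mathbf K^*),\qquad \mathbf K=\sum_{i,j}M_j^{i*}\otimes A_j^i\otimes\cdots\otimes A_j^i\quad(k\text{ factors }A_j^i,\ \text{strong convergence}),$$ for $a\in\mathcal B((H\otimes K)^{\otimes(1+k)})$, where $\mathrm{Tr}_{o]}$ is the partial trace over the last $k$ tensor factors. $\mathcal E_u$ is the copy of $\mathcal E$ on $\{u\}\cup S(u)$, and $\mathcal E_{W_n}=\bigotimes_{u\in W_n}\mathcal E_u$. For a product observable $a=a_o\otimes a_{W_1}\otimes\cdots\otimes a_{W_n}$ (each $a_{W_m}$ a product over $W_m$) put $$E_{o]}(a)=\mathcal E_o\big(a_o\otimes\mathcal E_{W_1}(a_{W_1}\otimes\cdots\otimes\mathcal E_{W_n}(a_{W_n}\otimes\mathbf 1))\big),$$ and for $b\in\mathcal A$ $$\psi_j(b)=\frac1{\mathrm{Tr}(\rho_j)}\sum_{i}\mathrm{Tr}\big((B_j^i\rho_jB_j^{i*}\otimes|i\rangle\langle i|)\,b\big).$$ A ray is a sequence $r=(x_n)_{n\ge0}$ with $x_0=o$ and $x_{n+1}\in S(x_n)$. For a projection $e\in\mathcal A$,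 with $e^\perp=\mathbf 1-e$, put $$\tau_{e;x_n}=e^{\perp(x_0)}\otimes\cdots\otimes e^{\perp(x_{n-1})}\otimes e^{(x_n)},\qquad \tau_{e;x_n;\infty}=e^{\perp(x_0)}\otimes\cdots\otimes e^{\perp(x_n)}$$ (with $\mathbf 1$ at all other vertices). For $l\in\{1,\dots,k\}$ let $e\otimes_l\tau$ denote $e$ at the root times the image of $\tau$ under the shift $u\mapsto(l,u)$ of the tree. The projection $e$ is *$\mathcal E$-recurrent* if $0<\mathrm{Tr}(\mathcal E(e\otimes\mathbf 1))<\infty$ and, for every ray $(x_n)$ and every $l$, $$\frac{1}{\mathrm{Tr}(\mathcal E(e\otimes\mathbf 1))}\,\mathrm{Tr}\Big(\sum_{n\ge0}E_{o]}(e\otimes_l\tau_{e;x_n})\Big)=1,$$ the sum converging in the strong operator topology. **Theorem.** Let $e\in\mathcal A$ be a projection with $p:=\sup_{j\in\Lambda}\psi_j(e^\perp)<1$. Then for every ray $(x_n)_n$ $$0\le E_{o]}(\tau_{e;x_n;\infty})\le p^n\,\mathbf 1\quad(n\ge0),\qquad\text{hence}\qquad \lim_{n\to\infty}E_{o]}(\tau_{e;x_n;\infty})=0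 \text{ in norm}.$$ Moreover $\mathrm{Tr}(\mathcal E(e\otimes\mathbf 1))>0$, and if $\mathrm{Tr}(\mathcal E(e\otimes\mathbf 1))<\infty$ (automatic when $H\otimes K$ is finite-dimensional), then $e$ is $\mathcal E$-recurrent. -/

import Mathlib

open Filter Topology ENNReal
open scoped TensorProduct InnerProductSpace

noncomputable section

namespace TreeQMC

/-! ### Strong operator sums and traces -/

section Operators

variable {E F : Type*} [NormedAddCommGroup E] [InnerProductSpace ℂ E]
  [NormedAddCommGroup F] [InnerProductSpace ℂ F]

/-- `∑ i, f i = T`, unconditionally in the strong operator topology. -/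
def HasSOTSum {ι : Type*} (f : ι → E →L[ℂ] F) (T : E →L[ℂ] F) : Prop :=
  ∀ x, HasSum (fun i => f i x) (T x)

open Classical in
/-- The sum `∑ i, f i` in the strong operator topology (`0` if the sum does not exist). -/
def sotSum {ι : Type*} (f : ι → E →L[ℂ] F) : E →L[ℂ] F :=
  if h : ∃ T, HasSOTSum f T then h.choose else 0

theorem HasSOTSum.unique {ι : Type*} {f : ι → E →L[ℂ] F} {S T : E →L[ℂ] F}
    (hS : HasSOTSum f S) (hT : HasSOTSum f T) : S = T :=
  ContinuousLinearMap.ext fun x => (hS x).unique (hT x)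

theorem HasSOTSum.sotSum_eq {ι : Type*} {f : ι → E →L[ℂ] F} {T : E →L[ℂ] F}
    (hT : HasSOTSum f T) : sotSum f = T := by
  have h : ∃ T, HasSOTSum f T := ⟨T, hT⟩
  rw [sotSum, dif_pos h]
  exact h.choose_spec.unique hT

variable (E) [CompleteSpace E]

/-- The index set of a fixed orthonormal basis of the Hilbert space `E`. -/
def BasisIndex : Set E := (exists_hilbertBasis ℂ E).choose

/-- A fixed orthonormal basis of the Hilbert space `E`, used to write traces. -/
def stdBasis : HilbertBasis (BasisIndex E) ℂ E := (exists_hilbertBasis ℂ E).choose_spec.choose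

variable {E}

/-- The trace, in `[0, ∞]`, of a positive operator. -/
def posTrace (T : E →L[ℂ] E) : ℝ≥0∞ :=
  ∑' i, ENNReal.ofReal (⟪stdBasis E i, T (stdBasis E i)⟫_ℂ).re

/-- The trace of a trace class operator. -/
def trace (T : E →L[ℂ] E) : ℂ :=
  ∑' i, ⟪stdBasis E i, T (stdBasis E i)⟫_ℂ

end Operators

/-! ### Tensor products of Hilbert spaces -/

section Tensor

/-- The tensor product `E ⊗ F` of two Hilbert spaces: the completion of the algebraic one. -/
abbrev HTensor (E F : Type*) [NormedAddCommGroup E] [InnerProductSpace ℂ E]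
    [NormedAddCommGroup F] [InnerProductSpace ℂ F] : Type _ :=
  UniformSpace.Completion (E ⊗[ℂ] F)

variable {E F E' F' : Type*} [NormedAddCommGroup E] [InnerProductSpace ℂ E]
  [NormedAddCommGroup F] [InnerProductSpace ℂ F]
  [NormedAddCommGroup E'] [InnerProductSpace ℂ E']
  [NormedAddCommGroup F'] [InnerProductSpace ℂ F']

/-- The elementary tensor `x ⊗ y`. -/
def htmul (x : E) (y : F) : HTensor E F := ((x ⊗ₜ[ℂ] y : E ⊗[ℂ] F) : HTensor E F)

/-- The bounded operator `f ⊗ g`, so that `(f ⊗ g) (x ⊗ y) = f x ⊗ g y`. -/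
def opTmul (f : E →L[ℂ] E') (g : F →L[ℂ] F') : HTensor E F →L[ℂ] HTensor E' F' :=
  (TensorProduct.mapL f g).completion

theorem opTmul_htmul (f : E →L[ℂ] E') (g : F →L[ℂ] F') (x : E) (y : F) :
    opTmul f g (htmul x y) = htmul (f x) (g y) := by
  simp [opTmul, htmul]

/-- The bounded operator `x ↦ x ⊗ y`. -/
def tmulRight (y : F) : E →L[ℂ] HTensor E F :=
  UniformSpace.Completion.toComplL ∘L (TensorProduct.mkL ℂ E F).flip y

theorem tmulRight_apply (x : E) (y : F) : tmulRight y x = htmul x y := by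
  simp [tmulRight, htmul]

/-- A bundled complex Hilbert space. -/
structure Hilb where
  carrier : Type*
  [normed : NormedAddCommGroup carrier]
  [inner : InnerProductSpace ℂ carrier]
  [complete : CompleteSpace carrier]

attribute [instance] Hilb.normed Hilb.inner Hilb.complete

variable (X : Type*) [NormedAddCommGroup X] [InnerProductSpace ℂ X] [CompleteSpace X]

/-- The Hilbert space `X ⊗ X^{⊗ k}` of a vertex `u` (first factor) and `k` successors. -/
def vertexSpace : ℕ → Hilb
  | 0 => ⟨X⟩
  | k + 1 => ⟨HTensor (vertexSpace k).carrier X⟩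

/-- `B(X ⊗ X^{⊗ k})`, the observables on a vertex together with `k` successors. -/
abbrev VertexAlg (k : ℕ) : Type _ := (vertexSpace X k).carrier →L[ℂ] (vertexSpace X k).carrier

variable {X}

/-- The elementary tensor `a ⊗ b₁ ⊗ ⋯ ⊗ b_k`. -/
def opTensor : (k : ℕ) → (X →L[ℂ] X) → (Fin k → X →L[ℂ] X) → VertexAlg X k
  | 0, a, _ => a
  | k + 1, a, b => opTmul (opTensor k a (Fin.init b)) (b (Fin.last k))

/-- The bounded operator `x ↦ x ⊗ β₁ ⊗ ⋯ ⊗ β_k`. -/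
def tensorRight : (k : ℕ) → (Fin k → X) → X →L[ℂ] (vertexSpace X k).carrier
  | 0, _ => ContinuousLinearMap.id ℂ X
  | k + 1, β => tmulRight (β (Fin.last k)) ∘L tensorRight k (Fin.init β)

/-- The partial trace `Tr_{u]} : B(X ⊗ X^{⊗ k}) → B(X)` over the successors: the operator with
`⟪x, Tr_{u]}(T) y⟫ = ∑_β ⟪x ⊗ β₁ ⊗ ⋯ ⊗ β_k, T (y ⊗ β₁ ⊗ ⋯ ⊗ β_k)⟫`, where `(β₁, …, β_k)` runs over
the tuples of elements of an orthonormal basis of `X`. -/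
def partialTrace (k : ℕ) (T : VertexAlg X k) : X →L[ℂ] X :=
  sotSum fun β : Fin k → BasisIndex X =>
    (tensorRight k fun l => stdBasis X (β l)).adjoint ∘L T ∘L
      (tensorRight k fun l => stdBasis X (β l))

end Tensor

/-! ### Open quantum random walks -/

/-- The data of an open quantum random walk on the vertex set `Λ`: an orthonormal basis
`(|i⟩)_{i ∈ Λ}` of `K`, bounded operators `B i j` on `H` (the effect of passing from `|j⟩` to `|i⟩`)
with `∑ i, (B i j)* (B i j) = 1` strongly, and an initial density matrix
`ρ = ∑ i, ρ i ⊗ |i⟩⟨i|` all of whose blocks are non-zero. -/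
structure OQRW (H K Λ : Type*) [NormedAddCommGroup H] [InnerProductSpace ℂ H] [CompleteSpace H]
    [NormedAddCommGroup K] [InnerProductSpace ℂ K] [CompleteSpace K] where
  basis : HilbertBasis Λ ℂ K
  B : Λ → Λ → H →L[ℂ] H
  hasSum_B : ∀ j, HasSOTSum (fun i => (B i j).adjoint ∘L B i j) (ContinuousLinearMap.id ℂ H)
  ρ : Λ → H →L[ℂ] H
  ρ_nonneg : ∀ i, 0 ≤ ρ i
  ρ_ne_zero : ∀ i, ρ i ≠ 0
  trace_ρ : ∑' i, posTrace (ρ i) = 1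

namespace OQRW

variable {H K Λ : Type*} [NormedAddCommGroup H] [InnerProductSpace ℂ H] [CompleteSpace H]
  [NormedAddCommGroup K] [InnerProductSpace ℂ K] [CompleteSpace K] (W : OQRW H K Λ)

/-- `|i⟩⟨j|` on `K`. -/
def ketBra (i j : Λ) : K →L[ℂ] K := InnerProductSpace.rankOne ℂ (W.basis i) (W.basis j)

/-- `Tr(ρ_j)`. -/
def trρ (j : Λ) : ℝ := (posTrace (W.ρ j)).toReal

/-- `M^i_j = B^i_j ⊗ |i⟩⟨j|`. -/
def M (i j : Λ) : HTensor H K →L[ℂ] HTensor H K := opTmul (W.B i j) (W.ketBra i j)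

/-- `A^i_j = Tr(ρ_j)^{-1/2} ρ_j^{1/2} ⊗ |i⟩⟨j|`. -/
def A (i j : Λ) : HTensor H K →L[ℂ] HTensor H K :=
  opTmul (((1 / √(W.trρ j) : ℝ) : ℂ) • CFC.sqrt (W.ρ j)) (W.ketBra i j)

/-- `K^{(u,S(u))} = ∑_{i,j} (M^i_j)* ⊗ A^i_j ⊗ ⋯ ⊗ A^i_j`, strongly convergent. -/
def kraus (k : ℕ) : VertexAlg (HTensor H K) k :=
  sotSum fun p : Λ × Λ => opTensor k (W.M p.1 p.2).adjoint fun _ => W.A p.1 p.2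

/-- The transition expectation `𝓔(a) = Tr_{u]}(K a K*)` from `B((H ⊗ K)^{⊗ (1 + k)})`, the
observables of a vertex and its `k` direct successors, to `B(H ⊗ K)`. -/
def transition (k : ℕ) (a : VertexAlg (HTensor H K) k) : HTensor H K →L[ℂ] HTensor H K :=
  partialTrace k (W.kraus k ∘L a ∘L (W.kraus k).adjoint)

/-- `ψ_j(b) = Tr(ρ_j)⁻¹ ∑_i Tr((B^i_j ρ_j (B^i_j)* ⊗ |i⟩⟨i|) b)`. -/
def ψ (j : Λ) (b : HTensor H K →L[ℂ] HTensor H K) : ℂ :=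
  ((1 / W.trρ j : ℝ) : ℂ) *
    ∑' i, trace (opTmul (W.B i j ∘L W.ρ j ∘L (W.B i j).adjoint) (W.ketBra i i) ∘L b)

end OQRW

/-! ### The Cayley tree, product observables and the quantum Markov chain -/

/-- Vertices of the semi-infinite Cayley tree of order `k` in coordinates: the root is `[]`, and the
direct successors of `u` are `u ++ [l]`, `l = 1, …, k`. -/
abbrev Vertex (k : ℕ) : Type := List (Fin k)

/-- A ray `(x_n)_n` of the tree issued from the root. -/
structure Ray (k : ℕ) where
  x : ℕ → Vertex k
  root : x 0 = []
  succ : ∀ n, ∃ l, x (n + 1) = x n ++ [l]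

/-- A product observable `⊗_u a_u` on the tree, given by its factors. -/
abbrev ProdObs (k : ℕ) (X : Type*) [NormedAddCommGroup X] [InnerProductSpace ℂ X] : Type _ :=
  Vertex k → X →L[ℂ] X

section Stopping

variable {k : ℕ} {X : Type*} [NormedAddCommGroup X] [InnerProductSpace ℂ X]

open Classical in
/-- `τ_{e;x_n}`: `e^⊥` at `x_0, …, x_{n-1}`, `e` at `x_n` and `1` at all other vertices. -/
def tau (e : X →L[ℂ] X) (r : Ray k) (n : ℕ) : ProdObs k X := fun u =>
  if u = r.x n then e else if ∃ m < n, u = r.x m then 1 - e else 1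

open Classical in
/-- `τ_{e;x_n;∞}`: `e^⊥` at `x_0, …, x_n` and `1` at all other vertices. -/
def tauInf (e : X →L[ℂ] X) (r : Ray k) (n : ℕ) : ProdObs k X := fun u =>
  if ∃ m ≤ n, u = r.x m then 1 - e else 1

/-- `a_o ⊗ α_l(a)`: the observable `a_o` at the root times the image of `a` under the shift
`α_l : x ↦ (l, x)` of the tree. -/
def rootTensor (ao : X →L[ℂ] X) (l : Fin k) (a : ProdObs k X) : ProdObs k X
  | [] => ao
  | j :: x => if j = l then a x else 1

end Stopping

namespace OQRW

variable {H K Λ : Type*} [NormedAddCommGroup H] [InnerProductSpace ℂ H] [CompleteSpace H]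
  [NormedAddCommGroup K] [InnerProductSpace ℂ K] [CompleteSpace K] (W : OQRW H K Λ) {k : ℕ}

/-- `W.iterate a m u` is the factor at `u` of
`𝓔_{W_d}(a_{W_d} ⊗ 𝓔_{W_{d+1}}(a_{W_{d+1}} ⊗ ⋯ 𝓔_{W_{d+m-1}}(a_{W_{d+m-1}} ⊗ 1)))`, where `d` is the
level of `u`; here `𝓔_{W_n} = ⊗_{u ∈ W_n} 𝓔_u` with `𝓔_u` the copy of `𝓔` at `{u} ∪ S(u)`. -/
def iterate (a : ProdObs k (HTensor H K)) : ℕ → Vertex k → HTensor H K →L[ℂ] HTensor H K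
  | 0, _ => 1
  | m + 1, u => W.transition k (opTensor k (a u) fun l => iterate a m (u ++ [l]))

/-- The conditional expectation
`E_{o]}(a) = 𝓔_o(a_o ⊗ 𝓔_{W_1}(a_{W_1} ⊗ ⋯ 𝓔_{W_n}(a_{W_n} ⊗ 1)))` of a product observable
`a = ⊗_u a_u` with `a_u = 1` beyond level `n`. -/
def condExp (n : ℕ) (a : ProdObs k (HTensor H K)) : HTensor H K →L[ℂ] HTensor H K :=
  W.iterate a (n + 1) []

/-- `Tr(𝓔(e ⊗ 1))`. -/
def normalizer (k : ℕ) (e : HTensor H K →L[ℂ] HTensor H K) : ℝ≥0∞ :=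
  posTrace (W.transition k (opTensor k e fun _ => 1))

/-- `𝓔`-recurrence of `e`: `0 < Tr(𝓔(e ⊗ 1)) < ∞`, and for every ray
`Tr(E_{o]}(∑ n, e ⊗ τ_{e;x_n})) / Tr(𝓔(e ⊗ 1)) = 1`. Here `e ⊗ τ` is `e` at the root times the
copy of `τ` in the subtree issued from a direct successor `(l)` of the root; all `l` are required. -/
def IsRecurrent (k : ℕ) (e : HTensor H K →L[ℂ] HTensor H K) : Prop :=
  0 < W.normalizer k e ∧ W.normalizer k e < ∞ ∧
    ∀ (r : Ray k) (l : Fin k), ∃ S : HTensor H K →L[ℂ] HTensor H K,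
      HasSOTSum (fun n => W.condExp (n + 1) (rootTensor e l (tau e r n))) S ∧
        posTrace S / W.normalizer k e = 1

end OQRW

end TreeQMC

end

noncomputable section

namespace TreeQMC

open scoped NNReal

/-! Everything rests on one formula for `transition`. The summands of K have pairwise orthogonal
supports and pairwise orthogonal ranges, so K* is the strong sum of their adjoints. Take a
projection a and positive operators b_l that are diagonal with respect to the sectors H ⊗ |j⟩. In a
product basis adapted to the sectors the cross terms vanish, and 𝓔(a ⊗ b_1 ⊗ ⋯ ⊗ b_k) = ∑_{i,j} w_j
(M^i_j)* a M^i_j, where w_j is the product over l of the values of the state ρ_j/Tr(ρ_j) ⊗ |j⟩⟨j| at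
b_l (`transition_opTensor`). This is `weighted a w`.

Such an operator is again positive and block diagonal, and its value in the j-th state is w_j ψ_j(a)
(`blockState_weighted`). The label j is therefore conserved down the tree, and iteration merely
multiplies weights. Since 𝓔(1) = 1, branches off the ray contribute 1, and an observable carried by
a ray gives `weighted` of its root factor with w_j the product of the ψ_j-values of the later
factors (`iterate_ray`).

Put q_j = ψ_j(e^⊥) ≤ p. Survival up to level n has root factor e^⊥ and weight q_j^n, and ∑ (M^i_j)*
M^i_j = 1 gives the bound p^n. A first return after n failures has root factor e and weight q_j^n (1
- q_j). These weights telescope to 1, so the sum is 𝓔(e ⊗ 1) itself and the normalized trace is 1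
(`hasSOTSum_weighted_geometric`).

Most identities between positive operators are checked on quadratic forms with values in [0, ∞],
where sums may be interchanged freely. -/

theorem ofReal_norm_sq {E : Type*} [SeminormedAddCommGroup E] (x : E) :
    ENNReal.ofReal (‖x‖ ^ 2) = ‖x‖ₑ ^ 2 := by
  rw [ENNReal.ofReal_pow (norm_nonneg x), ofReal_norm]

theorem summable_norm_sq_iff {ι E : Type*} [SeminormedAddCommGroup E] {f : ι → E} :
    Summable (fun i => ‖f i‖ ^ 2) ↔ ∑' i, ‖f i‖ₑ ^ 2 ≠ ∞ := by
  constructor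
  · intro h
    have := h.tsum_ofReal_ne_top
    simpa only [ofReal_norm_sq] using this
  · intro h
    have := ENNReal.summable_toReal h
    simpa only [ENNReal.toReal_pow, toReal_enorm] using this

/-! ### Quadratic forms and Parseval's identity -/

section PreHilbert

variable {E : Type*} [NormedAddCommGroup E] [InnerProductSpace ℂ E]

/-- The quadratic form `⟪x, T x⟫` of a positive operator, in `[0, ∞]`. -/
def quadForm (T : E →L[ℂ] E) (x : E) : ℝ≥0∞ := ENNReal.ofReal (⟪x, T x⟫_ℂ).re

theorem quadForm_one (x : E) : quadForm (1 : E →L[ℂ] E) x = ‖x‖ₑ ^ 2 := by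
  rw [quadForm, ← ofReal_norm_sq]
  congr 1
  exact inner_self_eq_norm_sq (𝕜 := ℂ) x

/-- Pythagoras for a convergent orthogonal series: pairing the sum with `f i` leaves only the i-th
term. Completeness plays no role. -/
theorem enorm_sq_of_hasSum_orthogonal {ι : Type*} {f : ι → E} {x : E} (hf : HasSum f x)
    (h : ∀ i j, i ≠ j → ⟪f i, f j⟫_ℂ = 0) : ‖x‖ₑ ^ 2 = ∑' i, ‖f i‖ₑ ^ 2 := by
  have h1 (i : ι) : ⟪f i, x⟫_ℂ = ⟪f i, f i⟫_ℂ := by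
    have h2 := hf.mapL (innerSL ℂ (f i))
    exact h2.unique (hasSum_single i fun j hj => h i j hj.symm)
  have h3 : HasSum (fun i => ‖f i‖ ^ 2) (‖x‖ ^ 2) := by
    have h4 := Complex.hasSum_re (hf.mapL (innerSL ℂ x))
    convert! h4 using 1
    · ext i
      rw [innerSL_apply_apply, ← inner_conj_symm, h1, Complex.conj_re]
      exact (inner_self_eq_norm_sq (𝕜 := ℂ) _).symm
    · exact (inner_self_eq_norm_sq (𝕜 := ℂ) _).symm
  rw [← ofReal_norm_sq, ← h3.tsum_eq,
    ENNReal.ofReal_tsum_of_nonneg (fun i => by positivity) h3.summable]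
  simp only [ofReal_norm_sq]

theorem tsum_enorm_inner_sq {ι : Type*} (b : HilbertBasis ι ℂ E) (x : E) :
    ∑' i, ‖⟪b i, x⟫_ℂ‖ₑ ^ 2 = ‖x‖ₑ ^ 2 := by
  have h := b.hasSum_repr x
  rw [enorm_sq_of_hasSum_orthogonal h]
  · refine tsum_congr fun i => ?_
    rw [enorm_smul, b.repr_apply_apply]
    simp [enorm_eq_nnnorm, b.orthonormal.nnnorm_eq_one]
  · intro i j hij
    rw [inner_smul_left, inner_smul_right, b.orthonormal.inner_eq_zero hij]
    simp

theorem tendsto_zero_of_norm_le_pow {T : ℕ → E →L[ℂ] E} {p : ℝ} (hp0 : 0 ≤ p) (hp1 : p < 1)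
    (h : ∀ n, ‖T n‖ ≤ p ^ n) : Tendsto T atTop (𝓝 0) :=
  squeeze_zero_norm h (tendsto_pow_atTop_nhds_zero_of_lt_one hp0 hp1)

end PreHilbert

/-! ### Positive operators, projections and the operator order -/

section Hilbert

variable {E F : Type*} [NormedAddCommGroup E] [InnerProductSpace ℂ E] [CompleteSpace E]
  [NormedAddCommGroup F] [InnerProductSpace ℂ F] [CompleteSpace F]

theorem posTrace_eq_tsum_quadForm (T : E →L[ℂ] E) :
    posTrace T = ∑' i, quadForm T (stdBasis E i) := rfl

theorem re_inner_adjoint_comp (c : E →L[ℂ] F) (x : E) :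
    (⟪x, (c.adjoint ∘L c) x⟫_ℂ).re = ‖c x‖ ^ 2 := by
  rw [ContinuousLinearMap.comp_apply, ContinuousLinearMap.adjoint_inner_right]
  exact inner_self_eq_norm_sq (𝕜 := ℂ) (c x)

theorem quadForm_adjoint_comp (c : E →L[ℂ] F) (x : E) :
    quadForm (c.adjoint ∘L c) x = ‖c x‖ₑ ^ 2 := by
  rw [quadForm, re_inner_adjoint_comp, ofReal_norm_sq]

theorem adjoint_comp_nonneg (c : E →L[ℂ] F) : 0 ≤ c.adjoint ∘L c := by
  rw [ContinuousLinearMap.nonneg_iff_isPositive]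
  exact ContinuousLinearMap.isPositive_adjoint_comp_self c

theorem exists_eq_adjoint_comp {T : E →L[ℂ] E} (hT : 0 ≤ T) :
    ∃ c : E →L[ℂ] E, T = c.adjoint ∘L c :=
  CStarAlgebra.nonneg_iff_eq_star_mul_self.mp hT

theorem re_inner_nonneg {T : E →L[ℂ] E} (hT : 0 ≤ T) (x : E) : 0 ≤ (⟪x, T x⟫_ℂ).re := by
  obtain ⟨c, rfl⟩ := exists_eq_adjoint_comp hT
  rw [re_inner_adjoint_comp]
  positivity

/-- `quadForm` sees only the real part and truncates negative values to 0; positivity of both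
operators ensures that nothing is lost. -/
theorem le_of_quadForm_le {S T : E →L[ℂ] E} (hS : 0 ≤ S) (hT : 0 ≤ T)
    (h : ∀ x, quadForm S x ≤ quadForm T x) : S ≤ T := by
  rw [ContinuousLinearMap.nonneg_iff_isPositive] at hS hT
  rw [ContinuousLinearMap.le_def, ContinuousLinearMap.isPositive_def']
  refine ⟨hT.isSelfAdjoint.sub hS.isSelfAdjoint, fun x => ?_⟩
  have h1 := (ENNReal.ofReal_le_ofReal_iff (hT.re_inner_nonneg_right x)).1 (h x)
  rw [ContinuousLinearMap.reApplyInnerSelf_apply, ← inner_re_symm,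
    sub_apply, inner_sub_right]
  simpa using h1

theorem eq_of_quadForm_eq {S T : E →L[ℂ] E} (hS : 0 ≤ S) (hT : 0 ≤ T)
    (h : ∀ x, quadForm S x = quadForm T x) : S = T :=
  le_antisymm (le_of_quadForm_le hS hT fun x => (h x).le)
    (le_of_quadForm_le hT hS fun x => (h x).ge)

theorem adjoint_comp_self_of_isStarProjection {e : E →L[ℂ] E} (he : IsStarProjection e) :
    e.adjoint ∘L e = e := by
  have h1 : e.adjoint = e := he.isSelfAdjoint
  have h2 : e ∘L e = e := he.isIdempotentElem
  rw [h1, h2]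

theorem quadForm_of_isStarProjection {e : E →L[ℂ] E} (he : IsStarProjection e) (x : E) :
    quadForm e x = ‖e x‖ₑ ^ 2 := by
  rw [← quadForm_adjoint_comp, adjoint_comp_self_of_isStarProjection he]

theorem enorm_sq_add_of_isStarProjection {e : E →L[ℂ] E} (he : IsStarProjection e) (x : E) :
    ‖e x‖ₑ ^ 2 + ‖(1 - e) x‖ₑ ^ 2 = ‖x‖ₑ ^ 2 := by
  rw [← quadForm_of_isStarProjection he, ← quadForm_of_isStarProjection he.one_sub,
    ← quadForm_one, quadForm, quadForm, quadForm,
    ← ENNReal.ofReal_add (re_inner_nonneg he.nonneg x) (re_inner_nonneg he.one_sub.nonneg x)]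
  simp

theorem enorm_apply_le_of_isStarProjection {e : E →L[ℂ] E} (he : IsStarProjection e) (x : E) :
    ‖e x‖ₑ ^ 2 ≤ ‖x‖ₑ ^ 2 := by
  rw [← enorm_sq_add_of_isStarProjection he x]
  exact le_self_add

theorem quadForm_add {S T : E →L[ℂ] E} (hS : 0 ≤ S) (hT : 0 ≤ T) (x : E) :
    quadForm (S + T) x = quadForm S x + quadForm T x := by
  rw [quadForm, quadForm, quadForm,
    ← ENNReal.ofReal_add (re_inner_nonneg hS x) (re_inner_nonneg hT x)]
  simp

theorem le_smul_one_of_quadForm_le {T : E →L[ℂ] E} (hT : 0 ≤ T) {c : ℝ} (hc : 0 ≤ c)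
    (h : ∀ x, quadForm T x ≤ ENNReal.ofReal c * ‖x‖ₑ ^ 2) : T ≤ (c : ℂ) • 1 := by
  have h0 : 0 ≤ (c : ℂ) • (1 : E →L[ℂ] E) := by
    rw [Complex.coe_smul]
    exact smul_nonneg hc zero_le_one
  refine le_of_quadForm_le hT h0 fun x => (h x).trans_eq ?_
  rw [← quadForm_one, quadForm, quadForm, ← ENNReal.ofReal_mul hc]
  simp

theorem norm_le_of_le_smul_one {T : E →L[ℂ] E} (hT : 0 ≤ T) {c : ℝ} (hc : 0 ≤ c)
    (h : T ≤ (c : ℂ) • 1) : ‖T‖ ≤ c := by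
  refine (CStarAlgebra.norm_le_norm_of_nonneg_of_le hT h).trans ?_
  rw [norm_smul, Complex.norm_real, Real.norm_of_nonneg hc]
  exact mul_le_of_le_one_right hc ContinuousLinearMap.norm_id_le

theorem isStarProjection_one : IsStarProjection (1 : E →L[ℂ] E) := IsStarProjection.one _

theorem isStarProjection_compl {e : E →L[ℂ] E} (he : IsStarProjection e) :
    IsStarProjection (1 - e) := he.one_sub

/-! ### Sums of positive operators -/

theorem HasSOTSum.hasSum_inner {ι : Type*} {R : ι → E →L[ℂ] F} {Z : E →L[ℂ] E}
    (h : HasSOTSum (fun i => (R i).adjoint ∘L R i) Z) (x y : E) :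
    HasSum (fun i => ⟪R i x, R i y⟫_ℂ) ⟪x, Z y⟫_ℂ := by
  have := (h y).mapL (innerSL ℂ x)
  simpa [ContinuousLinearMap.adjoint_inner_right] using this

theorem HasSOTSum.quadForm_eq {ι : Type*} {R : ι → E →L[ℂ] F} {Z : E →L[ℂ] E}
    (h : HasSOTSum (fun i => (R i).adjoint ∘L R i) Z) (x : E) :
    quadForm Z x = ∑' i, ‖R i x‖ₑ ^ 2 := by
  have h1 : HasSum (fun i => ‖R i x‖ ^ 2) (⟪x, Z x⟫_ℂ).re := by
    have := Complex.hasSum_re (h.hasSum_inner x x)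
    convert! this using 2 with i
    exact (inner_self_eq_norm_sq (𝕜 := ℂ) _).symm
  rw [quadForm, ← h1.tsum_eq, ENNReal.ofReal_tsum_of_nonneg (fun i => by positivity) h1.summable]
  simp only [ofReal_norm_sq]

/-- A family `R` with `∑ i, ‖R i x‖² ≤ C ‖x‖²` has a strongly convergent sum
`∑ i, (R i)* (R i)`. -/
theorem exists_hasSOTSum_adjoint_comp {ι : Type*} (R : ι → E →L[ℂ] F) (C : ℝ≥0)
    (h : ∀ x, ∑' i, ‖R i x‖ₑ ^ 2 ≤ C * ‖x‖ₑ ^ 2) :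
    ∃ Z : E →L[ℂ] E, 0 ≤ Z ∧ HasSOTSum (fun i => (R i).adjoint ∘L R i) Z := by
  have hfin (x : E) : Summable (fun i => ‖R i x‖ ^ 2) :=
    summable_norm_sq_iff.2 (ne_top_of_le_ne_top (by finiteness) (h x))
  have hmem (x : E) : Memℓp (fun i => R i x) 2 :=
    memℓp_gen (by simpa using hfin x)
  -- The family is one bounded map x ↦ (R i x)_i into ℓ²(ι; F). With `R'` denoting this map, Z = R'*
  -- R', and expanding R' x in coordinates gives strong convergence.
  let L : E →ₗ[ℂ] lp (fun _ : ι => F) 2 :=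
    { toFun := fun x => ⟨fun i => R i x, hmem x⟩
      map_add' := fun x y => by ext i; exact map_add (R i) x y
      map_smul' := fun c x => by ext i; exact map_smul (R i) c x }
  have hL (x : E) : ‖L x‖ ≤ √C * ‖x‖ := by
    have h1 : ‖L x‖ ^ 2 = ∑' i, ‖R i x‖ ^ 2 := by
      have := lp.norm_rpow_eq_tsum (p := 2) (by simp) (L x)
      simp only [ENNReal.toReal_ofNat, Real.rpow_ofNat] at this
      exact this
    have h2 : ‖L x‖ ^ 2 ≤ C * ‖x‖ ^ 2 := by
      rw [h1, ← ENNReal.ofReal_le_ofReal_iff (by positivity),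
        ENNReal.ofReal_tsum_of_nonneg (fun i => by positivity) (hfin x),
        ENNReal.ofReal_mul (by positivity), ofReal_norm_sq]
      simpa only [ofReal_norm_sq, ENNReal.ofReal_coe_nnreal] using h x
    refine le_of_sq_le_sq ?_ (by positivity)
    rwa [mul_pow, Real.sq_sqrt (by positivity)]
  let R' : E →L[ℂ] lp (fun _ : ι => F) 2 := L.mkContinuous _ hL
  refine ⟨R'.adjoint ∘L R', adjoint_comp_nonneg R', fun x => ?_⟩
  classical
  have h1 := (lp.hasSum_single (E := fun _ : ι => F) (p := 2) (by simp) (R' x)).mapL R'.adjoint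
  convert! h1 using 2 with i
  refine ext_inner_left ℂ fun y => ?_
  rw [ContinuousLinearMap.adjoint_inner_right, ContinuousLinearMap.comp_apply,
    ContinuousLinearMap.adjoint_inner_right, lp.inner_single_right]
  rfl

/-- The quadratic form is at most ‖Z‖ ‖x‖², so the family also has a positive strong sum; strong
sums are unique. -/
theorem HasSOTSum.nonneg {ι : Type*} {R : ι → E →L[ℂ] F} {Z : E →L[ℂ] E}
    (h : HasSOTSum (fun i => (R i).adjoint ∘L R i) Z) : 0 ≤ Z := by
  obtain ⟨Z', h0, hZ'⟩ := exists_hasSOTSum_adjoint_comp R ‖Z‖₊ fun x => by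
    rw [← h.quadForm_eq x, quadForm, ← ofReal_norm_sq, ← ENNReal.ofReal_coe_nnreal,
      ← ENNReal.ofReal_mul (by positivity)]
    refine ENNReal.ofReal_le_ofReal ((Complex.re_le_norm _).trans ?_)
    calc _ ≤ ‖x‖ * ‖Z x‖ := norm_inner_le_norm _ _
      _ ≤ ‖x‖ * (‖Z‖ * ‖x‖) := by gcongr; exact Z.le_opNorm x
      _ = _ := by rw [coe_nnnorm]; ring
  rwa [h.unique hZ']

/-- If the quadratic forms of the operators `(R i)* (R i)` add up to the one of `Z ≥ 0`, then the
operators add up to `Z` strongly. -/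
theorem hasSOTSum_of_quadForm_eq {ι : Type*} {R : ι → E →L[ℂ] F} {Z : E →L[ℂ] E} (hZ : 0 ≤ Z)
    (h : ∀ x, ∑' i, ‖R i x‖ₑ ^ 2 = quadForm Z x) :
    HasSOTSum (fun i => (R i).adjoint ∘L R i) Z := by
  obtain ⟨c, rfl⟩ := exists_eq_adjoint_comp hZ
  obtain ⟨Z', h0, hZ'⟩ := exists_hasSOTSum_adjoint_comp R (‖c‖₊ ^ 2) fun x => by
    rw [h, quadForm_adjoint_comp, ENNReal.coe_pow, ← mul_pow]
    gcongr
    exact c.le_opENorm x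
  rwa [eq_of_quadForm_eq hZ h0 fun x => by rw [hZ'.quadForm_eq, h]]

/-! ### Orthogonal families of operators -/

/-- Contractions with pairwise orthogonal supports satisfy Bessel's inequality. -/
theorem sum_norm_sq_apply_le {ι : Type*} {T : ι → E →L[ℂ] F} (h1 : ∀ i, ‖T i‖ ≤ 1)
    (h : ∀ i j, i ≠ j → T i ∘L (T j).adjoint = 0) (x : E) (s : Finset ι) :
    ∑ i ∈ s, ‖T i x‖ ^ 2 ≤ ‖x‖ ^ 2 := by
  -- Bessel's argument: ⟪x, y⟫ = a and ‖y‖² ≤ a, so Cauchy–Schwarz gives a ≤ ‖x‖ ‖y‖ ≤ (‖x‖² + a)/2.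
  set y := ∑ i ∈ s, (T i).adjoint (T i x) with hy
  set a := ∑ i ∈ s, ‖T i x‖ ^ 2 with ha
  have h2 : ⟪x, y⟫_ℂ = (a : ℂ) := by
    rw [hy, inner_sum, ha, Complex.ofReal_sum]
    refine Finset.sum_congr rfl fun i _ => ?_
    rw [ContinuousLinearMap.adjoint_inner_right, inner_self_eq_norm_sq_to_K]
    simp
  have h3 : ‖y‖ ^ 2 ≤ a := by
    rw [hy, @norm_sq_eq_re_inner ℂ]
    rw [sum_inner]
    have : ∀ i ∈ s, ⟪(T i).adjoint (T i x), ∑ j ∈ s, (T j).adjoint (T j x)⟫_ℂ =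
        ((‖(T i).adjoint (T i x)‖ ^ 2 : ℝ) : ℂ) := by
      intro i hi
      rw [inner_sum, Finset.sum_eq_single_of_mem i hi]
      · rw [inner_self_eq_norm_sq_to_K]; simp
      · intro j _ hj
        rw [ContinuousLinearMap.adjoint_inner_left, ← ContinuousLinearMap.comp_apply,
          h i j hj.symm]
        simp
    rw [Finset.sum_congr rfl this, ← Complex.ofReal_sum]
    simp only [RCLike.re_to_complex, Complex.ofReal_re]
    refine Finset.sum_le_sum fun i _ => ?_
    gcongr
    refine ((T i).adjoint.le_opNorm _).trans ?_
    rw [LinearIsometryEquiv.norm_map]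
    exact mul_le_of_le_one_left (norm_nonneg _) (h1 i)
  have ha0 : 0 ≤ a := Finset.sum_nonneg fun i _ => by positivity
  have h4 : a ≤ ‖x‖ * ‖y‖ := by
    have := norm_inner_le_norm (𝕜 := ℂ) x y
    rwa [h2, Complex.norm_real, Real.norm_of_nonneg ha0] at this
  nlinarith [sq_nonneg (‖x‖ - ‖y‖)]

/-- Orthogonal supports (`h`) make ‖T i x‖² summable by Bessel; orthogonal ranges (`h'`) turn this
into convergence of the vectors T i x. -/
theorem exists_hasSOTSum_of_orthogonal {ι : Type*} {T : ι → E →L[ℂ] F} (h1 : ∀ i, ‖T i‖ ≤ 1)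
    (h : ∀ i j, i ≠ j → T i ∘L (T j).adjoint = 0)
    (h' : ∀ i j, i ≠ j → (T i).adjoint ∘L T j = 0) :
    ∃ S : E →L[ℂ] F, HasSOTSum T S := by
  have horth (x : E) (i j : ι) (hij : i ≠ j) : ⟪T i x, T j x⟫_ℂ = 0 := by
    rw [← ContinuousLinearMap.adjoint_inner_right, ← ContinuousLinearMap.comp_apply, h' i j hij]
    simp
  have hsq (x : E) : Summable fun i => ‖T i x‖ ^ 2 :=
    summable_of_sum_le (fun i => by positivity) (sum_norm_sq_apply_le h1 h x)
  have hsum (x : E) : Summable fun i => T i x := by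
    have hV : OrthogonalFamily ℂ (fun i => (T i).range) fun i => ((T i).range).subtypeₗᵢ := by
      rintro i j hij ⟨_, v, rfl⟩ ⟨_, w, rfl⟩
      change ⟪T i v, T j w⟫_ℂ = 0
      rw [← ContinuousLinearMap.adjoint_inner_right, ← ContinuousLinearMap.comp_apply, h' i j hij]
      simp
    exact (hV.summable_iff_norm_sq_summable fun i => ⟨T i x, x, rfl⟩).2 (hsq x)
  let L : E →ₗ[ℂ] F :=
    { toFun := fun x => ∑' i, T i x
      map_add' := fun x y => by simp [(hsum x).tsum_add (hsum y)]
      map_smul' := fun c x => by simp [(hsum x).tsum_const_smul c] }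
  refine ⟨L.mkContinuous 1 fun x => ?_, fun x => (hsum x).hasSum⟩
  have h2 := enorm_sq_of_hasSum_orthogonal (hsum x).hasSum (horth x)
  have h3 : ‖L x‖ₑ ^ 2 ≤ ‖x‖ₑ ^ 2 := by
    refine h2.le.trans (ENNReal.summable.tsum_le_of_sum_le fun s => ?_)
    simp only [← ofReal_norm_sq]
    rw [← ENNReal.ofReal_sum_of_nonneg fun i _ => by positivity]
    exact ENNReal.ofReal_le_ofReal (sum_norm_sq_apply_le h1 h x s)
  rw [← ofReal_norm_sq, ← ofReal_norm_sq, ENNReal.ofReal_le_ofReal_iff (by positivity)] at h3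
  rw [one_mul]
  exact le_of_sq_le_sq h3 (norm_nonneg _)

/-- Taking adjoints is not strongly continuous. Here it exchanges the two orthogonality hypotheses,
so the adjoint series converges too, and matrix elements identify its sum. -/
theorem HasSOTSum.adjoint_of_orthogonal {ι : Type*} {T : ι → E →L[ℂ] F} {S : E →L[ℂ] F}
    (hS : HasSOTSum T S) (h1 : ∀ i, ‖T i‖ ≤ 1)
    (h : ∀ i j, i ≠ j → T i ∘L (T j).adjoint = 0)
    (h' : ∀ i j, i ≠ j → (T i).adjoint ∘L T j = 0) :
    HasSOTSum (fun i => (T i).adjoint) S.adjoint := by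
  obtain ⟨S', hS'⟩ := exists_hasSOTSum_of_orthogonal (T := fun i => (T i).adjoint)
    (fun i => by rw [LinearIsometryEquiv.norm_map]; exact h1 i)
    (fun i j hij => by simpa using h' i j hij) (fun i j hij => by simpa using h i j hij)
  suffices S' = S.adjoint by rwa [← this]
  rw [ContinuousLinearMap.eq_adjoint_iff]
  intro y x
  have h2 := (hS x).mapL (innerSL ℂ y)
  have h3 := Complex.hasSum_conj'.2 ((hS' y).mapL (innerSL ℂ x))
  simp only [innerSL_apply_apply, inner_conj_symm, ContinuousLinearMap.adjoint_inner_left] at h2 h3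
  exact h3.unique h2

/-! ### Hilbert–Schmidt sums -/

/-- By Parseval both sides are ∑ |⟪b' j, L (b i)⟫|², summed in different orders. -/
theorem tsum_enorm_sq_adjoint {ι κ : Type*} (b : HilbertBasis ι ℂ E) (b' : HilbertBasis κ ℂ F)
    (L : E →L[ℂ] F) : ∑' j, ‖L.adjoint (b' j)‖ₑ ^ 2 = ∑' i, ‖L (b i)‖ₑ ^ 2 := by
  simp_rw [← tsum_enorm_inner_sq b (L.adjoint _), ← tsum_enorm_inner_sq b' (L _)]
  rw [ENNReal.tsum_comm]
  refine tsum_congr fun i => tsum_congr fun j => ?_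
  rw [ContinuousLinearMap.adjoint_inner_right, ← inner_conj_symm, RCLike.enorm_conj]

theorem tsum_enorm_sq_basis_indep {ι κ : Type*} (b : HilbertBasis ι ℂ E) (b' : HilbertBasis κ ℂ E)
    (L : E →L[ℂ] F) : ∑' i, ‖L (b i)‖ₑ ^ 2 = ∑' j, ‖L (b' j)‖ₑ ^ 2 := by
  rw [← tsum_enorm_sq_adjoint b (stdBasis F), ← tsum_enorm_sq_adjoint b' (stdBasis F)]

theorem norm_le_one_of_tsum_enorm_sq_le {ι : Type*} (b : HilbertBasis ι ℂ E) (L : E →L[ℂ] F)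
    (h : ∑' i, ‖L (b i)‖ₑ ^ 2 ≤ 1) : ‖L‖ ≤ 1 := by
  rw [← LinearIsometryEquiv.norm_map ContinuousLinearMap.adjoint L]
  refine ContinuousLinearMap.opNorm_le_bound _ zero_le_one fun y => ?_
  have h1 : ‖L.adjoint y‖ₑ ^ 2 ≤ ‖y‖ₑ ^ 2 := by
    rw [← tsum_enorm_inner_sq b]
    calc _ ≤ ∑' i, ‖L (b i)‖ₑ ^ 2 * ‖y‖ₑ ^ 2 := by
          refine ENNReal.tsum_le_tsum fun i => ?_
          rw [ContinuousLinearMap.adjoint_inner_right, ← mul_pow]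
          gcongr
          rw [← ofReal_norm, ← ofReal_norm, ← ofReal_norm, ← ENNReal.ofReal_mul (norm_nonneg _)]
          exact ENNReal.ofReal_le_ofReal (norm_inner_le_norm _ _)
      _ ≤ _ := by
          rw [ENNReal.tsum_mul_right]
          exact mul_le_of_le_one_left zero_le h
  rw [← ofReal_norm_sq, ← ofReal_norm_sq, ENNReal.ofReal_le_ofReal_iff (by positivity)] at h1
  rw [one_mul]
  exact le_of_sq_le_sq h1 (norm_nonneg _)

/-- `Tr (S T*) = Tr (T* S)` for Hilbert–Schmidt operators. -/
theorem tsum_inner_adjoint_comm {ι κ : Type*} (b : HilbertBasis ι ℂ E) (b' : HilbertBasis κ ℂ F)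
    (S T : E →L[ℂ] F) (hS : ∑' i, ‖S (b i)‖ₑ ^ 2 ≠ ∞) (hT : ∑' i, ‖T (b i)‖ₑ ^ 2 ≠ ∞) :
    ∑' j, ⟪S.adjoint (b' j), T.adjoint (b' j)⟫_ℂ = ∑' i, ⟪T (b i), S (b i)⟫_ℂ := by
  have key (L : E →L[ℂ] F) (hL : ∑' i, ‖L (b i)‖ₑ ^ 2 ≠ ∞) :
      Summable fun p : κ × ι => ‖⟪b' p.1, L (b p.2)⟫_ℂ‖ ^ 2 := by
    rw [summable_norm_sq_iff,
      ENNReal.tsum_prod' (f := fun p : κ × ι => ‖⟪b' p.1, L (b p.2)⟫_ℂ‖ₑ ^ 2),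
      ENNReal.tsum_comm]
    simpa only [tsum_enorm_inner_sq] using hL
  -- Absolute summability, from 2|s t| ≤ |s|² + |t|², permits the interchange of the complex double
  -- sum.
  have hsum : Summable fun p : κ × ι => ⟪b' p.1, S (b p.2)⟫_ℂ * ⟪T (b p.2), b' p.1⟫_ℂ := by
    refine Summable.of_norm_bounded ((key S hS).add (key T hT)) fun p => ?_
    rw [norm_mul, norm_inner_symm (T _)]
    nlinarith [sq_nonneg (‖⟪b' p.1, S (b p.2)⟫_ℂ‖ - ‖⟪b' p.1, T (b p.2)⟫_ℂ‖),
      sq_nonneg (‖⟪b' p.1, S (b p.2)⟫_ℂ‖ + ‖⟪b' p.1, T (b p.2)⟫_ℂ‖)]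
  have h1 (j : κ) : ⟪S.adjoint (b' j), T.adjoint (b' j)⟫_ℂ =
      ∑' i, ⟪b' j, S (b i)⟫_ℂ * ⟪T (b i), b' j⟫_ℂ := by
    rw [← (b.hasSum_inner_mul_inner _ _).tsum_eq]
    simp only [ContinuousLinearMap.adjoint_inner_left, ContinuousLinearMap.adjoint_inner_right]
  have h2 (i : ι) : ⟪T (b i), S (b i)⟫_ℂ = ∑' j, ⟪b' j, S (b i)⟫_ℂ * ⟪T (b i), b' j⟫_ℂ := by
    rw [← (b'.hasSum_inner_mul_inner _ _).tsum_eq]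
    simp only [mul_comm]
  simp_rw [h1, h2]
  exact (Summable.tsum_comm (f := fun j i => ⟪b' j, S (b i)⟫_ℂ * ⟪T (b i), b' j⟫_ℂ) hsum).symm

/-- Distributivity, by splitting off the last coordinate. It makes the sum over basis tuples in the
partial trace factor over the successors. -/
theorem tsum_prod_pi {κ : Type*} :
    ∀ (k : ℕ) (f : Fin k → κ → ℝ≥0∞),
      ∑' β : Fin k → κ, ∏ l, f l (β l) = ∏ l, ∑' x, f l x
  | 0, f => by simp
  | k + 1, f => by
    rw [← (Fin.snocEquiv fun _ : Fin (k + 1) => κ).tsum_eq, ENNReal.tsum_prod',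
      Fin.prod_univ_castSucc, ← tsum_prod_pi k, ← ENNReal.tsum_mul_left]
    refine tsum_congr fun x => ?_
    rw [mul_comm, ← ENNReal.tsum_mul_left]
    refine tsum_congr fun β => ?_
    simp [Fin.snocEquiv, Fin.prod_univ_castSucc, mul_comm]

end Hilbert

/-! ### Completed tensor products of two Hilbert spaces -/

section HTensorLemmas

variable {E F E' F' E'' F'' G : Type*} [NormedAddCommGroup E] [InnerProductSpace ℂ E]
  [NormedAddCommGroup F] [InnerProductSpace ℂ F]
  [NormedAddCommGroup E'] [InnerProductSpace ℂ E']
  [NormedAddCommGroup F'] [InnerProductSpace ℂ F']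
  [NormedAddCommGroup E''] [InnerProductSpace ℂ E'']
  [NormedAddCommGroup F''] [InnerProductSpace ℂ F'']
  [NormedAddCommGroup G] [InnerProductSpace ℂ G]

theorem HTensor.ext {f g : HTensor E F →L[ℂ] G} (h : ∀ x y, f (htmul x y) = g (htmul x y)) :
    f = g := by
  refine ContinuousLinearMap.ext fun z => ?_
  induction z using UniformSpace.Completion.induction_on with
  | hp => exact isClosed_eq f.continuous g.continuous
  | ih z =>
    induction z using TensorProduct.induction_on with
    | zero => rw [UniformSpace.Completion.coe_zero, map_zero, map_zero]
    | tmul x y => exact h x y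
    | add a b ha hb => rw [UniformSpace.Completion.coe_add, map_add, map_add, ha, hb]

theorem HTensor.ext_inner {v w : HTensor E F}
    (h : ∀ x y, ⟪v, htmul x y⟫_ℂ = ⟪w, htmul x y⟫_ℂ) : v = w :=
  ext_inner_right ℂ fun z => DFunLike.congr_fun
    (HTensor.ext h : innerSL ℂ v = innerSL ℂ w) z

theorem inner_htmul (x x' : E) (y y' : F) :
    ⟪htmul x y, htmul x' y'⟫_ℂ = ⟪x, x'⟫_ℂ * ⟪y, y'⟫_ℂ := by
  simp [htmul]

theorem enorm_htmul (x : E) (y : F) : ‖htmul x y‖ₑ = ‖x‖ₑ * ‖y‖ₑ := by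
  rw [← ofReal_norm, ← ofReal_norm, ← ofReal_norm, ← ENNReal.ofReal_mul (norm_nonneg _)]
  simp [htmul]

theorem htmul_zero (x : E) : htmul x (0 : F) = 0 := by simp [htmul]

theorem zero_htmul (y : F) : htmul (0 : E) y = 0 := by simp [htmul]

theorem htmul_smul (c : ℂ) (x : E) (y : F) : htmul x (c • y) = c • htmul x y := by simp [htmul]

theorem smul_htmul (c : ℂ) (x : E) (y : F) : htmul (c • x) y = c • htmul x y := by
  simp [htmul, ← TensorProduct.smul_tmul']

theorem opTmul_comp (f : E →L[ℂ] E') (g : F →L[ℂ] F') (f' : E' →L[ℂ] E'') (g' : F' →L[ℂ] F'') :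
    opTmul f' g' ∘L opTmul f g = opTmul (f' ∘L f) (g' ∘L g) :=
  HTensor.ext fun x y => by simp [opTmul_htmul]

theorem opTmul_zero (f : E →L[ℂ] E') : opTmul f (0 : F →L[ℂ] F') = 0 :=
  HTensor.ext fun x y => by simp [opTmul_htmul, htmul_zero]

theorem zero_opTmul (g : F →L[ℂ] F') : opTmul (0 : E →L[ℂ] E') g = 0 :=
  HTensor.ext fun x y => by simp [opTmul_htmul, zero_htmul]

theorem opTmul_norm_le (f : E →L[ℂ] E') (g : F →L[ℂ] F') : ‖opTmul f g‖ ≤ ‖f‖ * ‖g‖ := by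
  refine ContinuousLinearMap.opNorm_le_bound _ (by positivity) fun z => ?_
  induction z using UniformSpace.Completion.induction_on with
  | hp => exact isClosed_le (opTmul f g).continuous.norm (continuous_const.mul continuous_norm)
  | ih z =>
    rw [opTmul, ContinuousLinearMap.completion_apply_coe, UniformSpace.Completion.norm_coe,
      UniformSpace.Completion.norm_coe]
    exact (ContinuousLinearMap.le_opNorm _ z).trans (by
      gcongr
      exact TensorProduct.norm_mapL_le f g)

theorem opTmul_adjoint [CompleteSpace E] [CompleteSpace F] [CompleteSpace E'] [CompleteSpace F']
    (f : E →L[ℂ] E') (g : F →L[ℂ] F') :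
    (opTmul f g).adjoint = opTmul f.adjoint g.adjoint := by
  refine HTensor.ext fun x y => HTensor.ext_inner fun x' y' => ?_
  rw [ContinuousLinearMap.adjoint_inner_left, opTmul_htmul, opTmul_htmul, inner_htmul, inner_htmul,
    ContinuousLinearMap.adjoint_inner_left, ContinuousLinearMap.adjoint_inner_left]

/-- The bounded operator `y ↦ x ⊗ y`. -/
def tmulLeft (x : E) : F →L[ℂ] HTensor E F :=
  UniformSpace.Completion.toComplL ∘L TensorProduct.mkL ℂ E F x

theorem tmulLeft_apply (x : E) (y : F) : tmulLeft x y = htmul x y := by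
  simp [tmulLeft, htmul]

theorem eq_zero_of_inner_basis_eq_zero {ι : Type*} [CompleteSpace E] (b : HilbertBasis ι ℂ E)
    {x : E} (h : ∀ i, ⟪x, b i⟫_ℂ = 0) : x = 0 := by
  have := tsum_enorm_inner_sq b x
  simp_rw [← inner_conj_symm _ x, h] at this
  simpa using this.symm

/-- The Hilbert basis of `E ⊗ F` given by two Hilbert bases of `E` and `F`. -/
def prodBasis {ι κ : Type*} [CompleteSpace E] [CompleteSpace F] (b : HilbertBasis ι ℂ E)
    (b' : HilbertBasis κ ℂ F) : HilbertBasis (ι × κ) ℂ (HTensor E F) :=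
  HilbertBasis.mkOfOrthogonalEqBot (v := fun p : ι × κ => htmul (b p.1) (b' p.2))
    (by
      classical
      rw [orthonormal_iff_ite]
      rintro ⟨i, j⟩ ⟨i', j'⟩
      rw [inner_htmul, orthonormal_iff_ite.1 b.orthonormal, orthonormal_iff_ite.1 b'.orthonormal]
      by_cases h : i = i' <;> by_cases h' : j = j' <;> simp [h, h'])
    (by
      rw [Submodule.eq_bot_iff]
      intro v hv
      have h1 (i : ι) (j : κ) : ⟪v, htmul (b i) (b' j)⟫_ℂ = 0 :=
        (Submodule.mem_orthogonal' _ _).1 hv _ (Submodule.subset_span ⟨(i, j), rfl⟩)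
      -- Orthogonality passes from basis products to all elementary tensors one factor at a time.
      have h2 (x : E) (j : κ) : ⟪v, htmul x (b' j)⟫_ℂ = 0 := by
        rw [← tmulRight_apply, ← ContinuousLinearMap.adjoint_inner_left,
          eq_zero_of_inner_basis_eq_zero b (x := (tmulRight (b' j)).adjoint v), inner_zero_left]
        intro i
        rw [ContinuousLinearMap.adjoint_inner_left, tmulRight_apply, h1]
      refine HTensor.ext_inner fun x y => ?_
      rw [inner_zero_left, ← tmulLeft_apply, ← ContinuousLinearMap.adjoint_inner_left,
        eq_zero_of_inner_basis_eq_zero b' (x := (tmulLeft x).adjoint v), inner_zero_left]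
      intro j
      rw [ContinuousLinearMap.adjoint_inner_left, tmulLeft_apply, h2])

theorem prodBasis_apply {ι κ : Type*} [CompleteSpace E] [CompleteSpace F] (b : HilbertBasis ι ℂ E)
    (b' : HilbertBasis κ ℂ F) (p : ι × κ) : prodBasis b b' p = htmul (b p.1) (b' p.2) := by
  simp [prodBasis]

end HTensorLemmas

theorem eq_zero_of_posTrace_eq_zero {E : Type*} [NormedAddCommGroup E] [InnerProductSpace ℂ E]
    [CompleteSpace E] {T : E →L[ℂ] E} (hT : 0 ≤ T) (h : posTrace T = 0) : T = 0 := by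
  obtain ⟨c, rfl⟩ := exists_eq_adjoint_comp hT
  rw [posTrace_eq_tsum_quadForm] at h
  simp_rw [quadForm_adjoint_comp] at h
  rw [← tsum_enorm_sq_adjoint (stdBasis E) (stdBasis E), ENNReal.tsum_eq_zero] at h
  have hc (y : E) : c y = 0 := by
    refine eq_zero_of_inner_basis_eq_zero (stdBasis E) fun i => ?_
    rw [← ContinuousLinearMap.adjoint_inner_right]
    have := h i
    rw [sq_eq_zero_iff, enorm_eq_zero] at this
    rw [this, inner_zero_right]
  ext y
  simp [hc]

/-! ### Product operators and partial traces on a vertex and its successors -/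

section VertexSpace

variable {X : Type*} [NormedAddCommGroup X] [InnerProductSpace ℂ X] [CompleteSpace X]

theorem opTensor_succ (k : ℕ) (a : X →L[ℂ] X) (b : Fin (k + 1) → X →L[ℂ] X) :
    opTensor (k + 1) a b = opTmul (opTensor k a (Fin.init b)) (b (Fin.last k)) := rfl

theorem tensorRight_succ_apply (k : ℕ) (β : Fin (k + 1) → X) (x : X) :
    tensorRight (k + 1) β x = htmul (tensorRight k (Fin.init β) x) (β (Fin.last k)) :=
  tmulRight_apply _ _

theorem opTensor_comp : ∀ (k : ℕ) (a a' : X →L[ℂ] X) (b b' : Fin k → X →L[ℂ] X),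
    opTensor k a b ∘L opTensor k a' b' = opTensor k (a ∘L a') fun l => b l ∘L b' l
  | 0, _, _, _, _ => rfl
  | k + 1, a, a', b, b' => by
    rw [opTensor_succ, opTensor_succ, opTensor_succ]
    refine (opTmul_comp _ _ _ _).trans ?_
    rw [opTensor_comp k]
    rfl

theorem opTensor_adjoint : ∀ (k : ℕ) (a : X →L[ℂ] X) (b : Fin k → X →L[ℂ] X),
    (opTensor k a b).adjoint = opTensor k a.adjoint fun l => (b l).adjoint
  | 0, _, _ => rfl
  | k + 1, a, b => by
    rw [opTensor_succ, opTensor_succ]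
    refine (opTmul_adjoint _ _).trans ?_
    rw [opTensor_adjoint k]
    rfl

theorem opTensor_norm_le : ∀ (k : ℕ) (a : X →L[ℂ] X) (b : Fin k → X →L[ℂ] X),
    ‖a‖ ≤ 1 → (∀ l, ‖b l‖ ≤ 1) → ‖opTensor k a b‖ ≤ 1
  | 0, _, _ => fun h _ => h
  | k + 1, a, b => fun ha hb => by
    rw [opTensor_succ]
    refine (opTmul_norm_le _ _).trans ?_
    exact mul_le_one₀ (opTensor_norm_le k a _ ha fun l => hb _) (norm_nonneg _) (hb _)

theorem opTensor_zero_left : ∀ (k : ℕ) (b : Fin k → X →L[ℂ] X), opTensor k 0 b = 0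
  | 0, _ => rfl
  | k + 1, b => by
    rw [opTensor_succ, opTensor_zero_left k]
    exact zero_opTmul _

theorem opTensor_const_zero (k : ℕ) (hk : 1 ≤ k) (a : X →L[ℂ] X) :
    opTensor k a (fun _ => 0) = 0 := by
  obtain ⟨k, rfl⟩ : ∃ m, k = m + 1 := ⟨k - 1, by omega⟩
  rw [opTensor_succ]
  exact opTmul_zero _

theorem opTensor_tensorRight : ∀ (k : ℕ) (a : X →L[ℂ] X) (b : Fin k → X →L[ℂ] X) (β : Fin k → X)
    (x : X), opTensor k a b (tensorRight k β x) = tensorRight k (fun l => b l (β l)) (a x)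
  | 0, _, _, _, _ => rfl
  | k + 1, a, b, β, x => by
    rw [opTensor_succ, tensorRight_succ_apply, tensorRight_succ_apply]
    refine (opTmul_htmul _ _ _ _).trans ?_
    rw [opTensor_tensorRight k]
    rfl

theorem inner_tensorRight : ∀ (k : ℕ) (β γ : Fin k → X) (x y : X),
    ⟪tensorRight k β x, tensorRight k γ y⟫_ℂ = ⟪x, y⟫_ℂ * ∏ l, ⟪β l, γ l⟫_ℂ
  | 0, _, _, x, y => by
    rw [Fin.prod_univ_zero, mul_one]
    rfl
  | k + 1, β, γ, x, y => by
    rw [tensorRight_succ_apply, tensorRight_succ_apply, Fin.prod_univ_castSucc, ← mul_assoc]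
    refine (inner_htmul _ _ _ _).trans ?_
    rw [inner_tensorRight k]
    rfl

theorem enorm_tensorRight : ∀ (k : ℕ) (β : Fin k → X) (x : X),
    ‖tensorRight k β x‖ₑ = ‖x‖ₑ * ∏ l, ‖β l‖ₑ
  | 0, _, x => by
    rw [Fin.prod_univ_zero, mul_one]
    rfl
  | k + 1, β, x => by
    rw [tensorRight_succ_apply, Fin.prod_univ_castSucc, ← mul_assoc]
    refine (enorm_htmul _ _).trans ?_
    rw [enorm_tensorRight k]
    rfl

theorem tsum_tensorRight_succ {ι F : Type*} [NormedAddCommGroup F] [InnerProductSpace ℂ F] (k : ℕ)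
    (b : ι → X) (L : (vertexSpace X (k + 1)).carrier →L[ℂ] F) (x : X) :
    ∑' β : Fin (k + 1) → ι, ‖L (tensorRight (k + 1) (fun l => b (β l)) x)‖ₑ ^ 2 =
      ∑' i, ∑' β : Fin k → ι, ‖L (htmul (tensorRight k (fun l => b (β l)) x) (b i))‖ₑ ^ 2 := by
  rw [← (Fin.snocEquiv fun _ : Fin (k + 1) => ι).tsum_eq, ENNReal.tsum_prod']
  refine tsum_congr fun i => tsum_congr fun β => ?_
  rw [tensorRight_succ_apply]
  simp [Fin.snocEquiv, Fin.init_def]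

/-- The partial trace of a positive operator does not depend on the orthonormal basis. -/
theorem tsum_enorm_sq_tensorRight_basis_indep {ι κ F : Type*} [NormedAddCommGroup F]
    [InnerProductSpace ℂ F] [CompleteSpace F] (b : HilbertBasis ι ℂ X) (b' : HilbertBasis κ ℂ X) :
    ∀ (k : ℕ) (L : (vertexSpace X k).carrier →L[ℂ] F) (x : X),
      ∑' β : Fin k → ι, ‖L (tensorRight k (fun l => b (β l)) x)‖ₑ ^ 2 =
        ∑' β : Fin k → κ, ‖L (tensorRight k (fun l => b' (β l)) x)‖ₑ ^ 2
  | 0, L, x => by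
    rw [tsum_fintype, tsum_fintype]
    simp only [Finset.univ_unique, Finset.sum_singleton]
    rfl
  | k + 1, L, x => by
    rw [tsum_tensorRight_succ, tsum_tensorRight_succ]
    let L' : HTensor (vertexSpace X k).carrier X →L[ℂ] F := L
    have h2 (i : ι) :
        ∑' β : Fin k → ι, ‖L (htmul (tensorRight k (fun l => b (β l)) x) (b i))‖ₑ ^ 2 =
          ∑' β : Fin k → κ, ‖L (htmul (tensorRight k (fun l => b' (β l)) x) (b i))‖ₑ ^ 2 := by
      have h := tsum_enorm_sq_tensorRight_basis_indep b b' k (L' ∘L tmulRight (b i)) x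
      simp only [ContinuousLinearMap.comp_apply, tmulRight_apply] at h
      exact h
    rw [tsum_congr h2, ENNReal.tsum_comm, ENNReal.tsum_comm (α := κ)]
    refine tsum_congr fun β => ?_
    have h3 := tsum_enorm_sq_basis_indep b b' (L' ∘L tmulLeft (tensorRight k (fun l => b' (β l)) x))
    simp only [ContinuousLinearMap.comp_apply, tmulLeft_apply] at h3
    exact h3

end VertexSpace
/-! ### Rays -/

theorem Ray.length_x {k : ℕ} (r : Ray k) (n : ℕ) : (r.x n).length = n := by
  induction n with
  | zero => rw [r.root]; rfl
  | succ n ih =>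
    obtain ⟨l, hl⟩ := r.succ n
    rw [hl, List.length_append, ih]
    rfl

theorem Ray.x_injective {k : ℕ} (r : Ray k) : Function.Injective r.x := fun m n h => by
  rw [← r.length_x m, h, r.length_x]

/-- The image of a ray under the shift `u ↦ (l, u)`, continued to the root. -/
def Ray.shift {k : ℕ} (r : Ray k) (l : Fin k) : Ray k where
  x
    | 0 => []
    | n + 1 => l :: r.x n
  root := rfl
  succ
    | 0 => ⟨l, by simp [r.root]⟩
    | n + 1 => by
      obtain ⟨l', hl'⟩ := r.succ n
      exact ⟨l', by simp [hl']⟩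

/-! ### Sectors of H ⊗ K -/

namespace OQRW

variable {H K Λ : Type*} [NormedAddCommGroup H] [InnerProductSpace ℂ H] [CompleteSpace H]
  [NormedAddCommGroup K] [InnerProductSpace ℂ K] [CompleteSpace K] (W : OQRW H K Λ)

/-- The isometry `h ↦ h ⊗ |j⟩`, from `H` onto the sector of `|j⟩`. -/
def sector (j : Λ) : H →L[ℂ] HTensor H K := tmulRight (W.basis j)

/-- `Tr(ρ_j)^{-1/2} ρ_j^{1/2}`. -/
def sqrtState (j : Λ) : H →L[ℂ] H := ((1 / √(W.trρ j) : ℝ) : ℂ) • CFC.sqrt (W.ρ j)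

theorem sector_apply (j : Λ) (h : H) : W.sector j h = htmul h (W.basis j) := tmulRight_apply _ _

theorem inner_sector (i j : Λ) (h h' : H) :
    ⟪W.sector i h, W.sector j h'⟫_ℂ = ⟪h, h'⟫_ℂ * ⟪W.basis i, W.basis j⟫_ℂ := by
  rw [sector_apply, sector_apply, inner_htmul]

theorem inner_basis_self (i : Λ) : ⟪W.basis i, W.basis i⟫_ℂ = 1 := by
  simp [inner_self_eq_norm_sq_to_K, W.basis.orthonormal.norm_eq_one]

theorem enorm_sector (j : Λ) (h : H) : ‖W.sector j h‖ₑ = ‖h‖ₑ := by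
  rw [sector_apply, enorm_htmul, ← ofReal_norm (W.basis j), W.basis.orthonormal.norm_eq_one]
  simp

theorem sector_adjoint_htmul (j : Λ) (x : H) (y : K) :
    (W.sector j).adjoint (htmul x y) = ⟪W.basis j, y⟫_ℂ • x := by
  refine ext_inner_right ℂ fun h => ?_
  rw [ContinuousLinearMap.adjoint_inner_left, sector_apply, inner_htmul, inner_smul_left,
    inner_conj_symm, mul_comm]

theorem sector_adjoint_sector (j : Λ) (h : H) : (W.sector j).adjoint (W.sector j h) = h := by
  rw [sector_apply, sector_adjoint_htmul, inner_basis_self, one_smul]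

theorem sector_adjoint_sector_of_ne {i j : Λ} (hij : i ≠ j) (h : H) :
    (W.sector i).adjoint (W.sector j h) = 0 := by
  rw [sector_apply, sector_adjoint_htmul, W.basis.orthonormal.inner_eq_zero hij, zero_smul]

theorem opTmul_ketBra (f : H →L[ℂ] H) (i j : Λ) :
    opTmul f (W.ketBra i j) = W.sector i ∘L f ∘L (W.sector j).adjoint := by
  refine HTensor.ext fun x y => ?_
  rw [opTmul_htmul, ContinuousLinearMap.comp_apply, ContinuousLinearMap.comp_apply,
    sector_adjoint_htmul, map_smul, sector_apply, smul_htmul, ← htmul_smul]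
  rfl

theorem M_apply (i j : Λ) (x : HTensor H K) :
    W.M i j x = W.sector i (W.B i j ((W.sector j).adjoint x)) := by
  rw [M, opTmul_ketBra]
  rfl

theorem M_eq (i j : Λ) : W.M i j = W.sector i ∘L W.B i j ∘L (W.sector j).adjoint :=
  W.opTmul_ketBra _ i j

theorem A_eq (i j : Λ) : W.A i j = W.sector i ∘L W.sqrtState j ∘L (W.sector j).adjoint :=
  W.opTmul_ketBra _ i j

/-- Parseval in the product basis, grouped by the index of the basis of K. -/
theorem tsum_enorm_sector_adjoint (x : HTensor H K) :
    ∑' j, ‖(W.sector j).adjoint x‖ₑ ^ 2 = ‖x‖ₑ ^ 2 := by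
  rw [← tsum_enorm_inner_sq (prodBasis (stdBasis H) W.basis) x, ENNReal.tsum_prod',
    ENNReal.tsum_comm]
  refine tsum_congr fun j => ?_
  rw [← tsum_enorm_inner_sq (stdBasis H)]
  refine tsum_congr fun h => ?_
  rw [prodBasis_apply, ContinuousLinearMap.adjoint_inner_right, sector_apply]

/-! ### The blocks of the initial state -/

theorem posTrace_ρ_ne_top (j : Λ) : posTrace (W.ρ j) ≠ ∞ :=
  ne_top_of_le_ne_top ENNReal.one_ne_top (W.trace_ρ ▸ ENNReal.le_tsum j)

theorem sqrt_adjoint (j : Λ) : (CFC.sqrt (W.ρ j)).adjoint = CFC.sqrt (W.ρ j) :=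
  (CFC.sqrt_nonneg (W.ρ j)).isSelfAdjoint

theorem sqrt_comp_sqrt (j : Λ) : CFC.sqrt (W.ρ j) ∘L CFC.sqrt (W.ρ j) = W.ρ j :=
  CFC.sqrt_mul_sqrt_self (W.ρ j) (W.ρ_nonneg j)

theorem quadForm_ρ (j : Λ) (x : H) : quadForm (W.ρ j) x = ‖CFC.sqrt (W.ρ j) x‖ₑ ^ 2 := by
  rw [← quadForm_adjoint_comp, sqrt_adjoint, sqrt_comp_sqrt]

theorem posTrace_ρ_ne_zero (j : Λ) : posTrace (W.ρ j) ≠ 0 := fun h =>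
  W.ρ_ne_zero j (eq_zero_of_posTrace_eq_zero (W.ρ_nonneg j) h)

theorem trρ_pos (j : Λ) : 0 < W.trρ j :=
  ENNReal.toReal_pos (W.posTrace_ρ_ne_zero j) (W.posTrace_ρ_ne_top j)

theorem sqrtState_adjoint (j : Λ) : (W.sqrtState j).adjoint = W.sqrtState j := by
  rw [sqrtState, map_smulₛₗ, sqrt_adjoint, Complex.conj_ofReal]

theorem ρ_eq (j : Λ) :
    W.ρ j = ((W.trρ j : ℝ) : ℂ) • (W.sqrtState j ∘L W.sqrtState j) := by
  rw [sqrtState, ContinuousLinearMap.smul_comp, ContinuousLinearMap.comp_smul, sqrt_comp_sqrt,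
    smul_smul, smul_smul, ← Complex.ofReal_mul, ← Complex.ofReal_mul]
  have h := W.trρ_pos j
  have : W.trρ j * (1 / √(W.trρ j)) * (1 / √(W.trρ j)) = 1 := by
    rw [mul_assoc, div_mul_div_comm, Real.mul_self_sqrt h.le]
    field_simp
  rw [this, Complex.ofReal_one, one_smul]

theorem tsum_enorm_sqrtState (j : Λ) :
    ∑' h, ‖W.sqrtState j (stdBasis H h)‖ₑ ^ 2 = 1 := by
  have h (x : H) : ‖W.sqrtState j x‖ₑ ^ 2 = (posTrace (W.ρ j))⁻¹ * quadForm (W.ρ j) x := by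
    rw [quadForm_ρ, sqrtState, smul_apply, enorm_smul, mul_pow]
    congr 1
    rw [← ofReal_norm_sq, Complex.norm_real, Real.norm_eq_abs, sq_abs, div_pow,
      Real.sq_sqrt (W.trρ_pos j).le, one_pow, one_div, ENNReal.ofReal_inv_of_pos (W.trρ_pos j), trρ,
      ENNReal.ofReal_toReal (W.posTrace_ρ_ne_top j)]
  simp_rw [h]
  rw [ENNReal.tsum_mul_left, ← posTrace_eq_tsum_quadForm,
    ENNReal.inv_mul_cancel (W.posTrace_ρ_ne_zero j) (W.posTrace_ρ_ne_top j)]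

theorem tsum_enorm_B (j : Λ) (x : H) : ∑' i, ‖W.B i j x‖ₑ ^ 2 = ‖x‖ₑ ^ 2 := by
  rw [← (W.hasSum_B j).quadForm_eq x, ← quadForm_one]
  rfl

/-! ### The operator `K` -/

theorem norm_ketBra_le (i j : Λ) : ‖W.ketBra i j‖ ≤ 1 := by
  rw [ketBra, InnerProductSpace.norm_rankOne, W.basis.orthonormal.norm_eq_one,
    W.basis.orthonormal.norm_eq_one, one_mul]

theorem norm_B_le (i j : Λ) : ‖W.B i j‖ ≤ 1 := by
  refine ContinuousLinearMap.opNorm_le_bound _ zero_le_one fun x => ?_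
  have h : ‖W.B i j x‖ₑ ^ 2 ≤ ‖x‖ₑ ^ 2 := W.tsum_enorm_B j x ▸ ENNReal.le_tsum i
  rw [← ofReal_norm_sq, ← ofReal_norm_sq, ENNReal.ofReal_le_ofReal_iff (by positivity)] at h
  rw [one_mul]
  exact le_of_sq_le_sq h (norm_nonneg _)

theorem norm_M_le (i j : Λ) : ‖W.M i j‖ ≤ 1 :=
  (opTmul_norm_le _ _).trans
    (mul_le_one₀ (W.norm_B_le i j) (norm_nonneg _) (W.norm_ketBra_le i j))

theorem norm_A_le (i j : Λ) : ‖W.A i j‖ ≤ 1 :=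
  (opTmul_norm_le _ _).trans
    (mul_le_one₀ (norm_le_one_of_tsum_enorm_sq_le (stdBasis H) _ (W.tsum_enorm_sqrtState j).le)
      (norm_nonneg _) (W.norm_ketBra_le i j))

theorem sandwich_adjoint_comp_of_ne {i i' : Λ} (h : i ≠ i') (j j' : Λ) (f g : H →L[ℂ] H) :
    (W.sector i ∘L f ∘L (W.sector j).adjoint).adjoint ∘L
      (W.sector i' ∘L g ∘L (W.sector j').adjoint) = 0 := by
  ext x
  simp [ContinuousLinearMap.adjoint_comp, W.sector_adjoint_sector_of_ne h]

theorem sandwich_comp_adjoint_of_ne (i i' : Λ) {j j' : Λ} (h : j ≠ j') (f g : H →L[ℂ] H) :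
    (W.sector i ∘L f ∘L (W.sector j).adjoint) ∘L
      (W.sector i' ∘L g ∘L (W.sector j').adjoint).adjoint = 0 := by
  ext x
  simp [ContinuousLinearMap.adjoint_comp, W.sector_adjoint_sector_of_ne h]

/-- The summands of `K`. -/
def krausTerm (k : ℕ) (p : Λ × Λ) : VertexAlg (HTensor H K) k :=
  opTensor k (W.M p.1 p.2).adjoint fun _ => W.A p.1 p.2

theorem krausTerm_adjoint (k : ℕ) (p : Λ × Λ) : (W.krausTerm k p).adjoint =
    opTensor k (W.M p.1 p.2) fun _ => (W.A p.1 p.2).adjoint := by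
  rw [krausTerm, opTensor_adjoint, ContinuousLinearMap.adjoint_adjoint]

theorem norm_krausTerm_le (k : ℕ) (p : Λ × Λ) : ‖W.krausTerm k p‖ ≤ 1 :=
  opTensor_norm_le k _ _ (by rw [LinearIsometryEquiv.norm_map]; exact W.norm_M_le _ _)
    fun _ => W.norm_A_le _ _

/-- Different i are separated by the M factors, different j by the A factors; in
`krausTerm_adjoint_comp` the roles are exchanged. The A factors exist only when there is a
successor, hence `1 ≤ k`. -/
theorem krausTerm_comp_adjoint {k : ℕ} (hk : 1 ≤ k) (p q : Λ × Λ) (hpq : p ≠ q) :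
    W.krausTerm k p ∘L (W.krausTerm k q).adjoint = 0 := by
  rw [krausTerm_adjoint, krausTerm, opTensor_comp]
  by_cases h : p.1 = q.1
  · have h' : p.2 ≠ q.2 := fun h' => hpq (Prod.ext h h')
    rw [A_eq, A_eq, W.sandwich_comp_adjoint_of_ne _ _ h', opTensor_const_zero k hk]
  · rw [M_eq, M_eq, W.sandwich_adjoint_comp_of_ne h, opTensor_zero_left]

theorem krausTerm_adjoint_comp {k : ℕ} (hk : 1 ≤ k) (p q : Λ × Λ) (hpq : p ≠ q) :
    (W.krausTerm k p).adjoint ∘L W.krausTerm k q = 0 := by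
  rw [krausTerm_adjoint, krausTerm, opTensor_comp]
  by_cases h : p.1 = q.1
  · have h' : p.2 ≠ q.2 := fun h' => hpq (Prod.ext h h')
    rw [M_eq, M_eq, W.sandwich_comp_adjoint_of_ne _ _ h', opTensor_zero_left]
  · rw [A_eq, A_eq, W.sandwich_adjoint_comp_of_ne h, opTensor_const_zero k hk]

theorem hasSOTSum_kraus_adjoint {k : ℕ} (hk : 1 ≤ k) :
    HasSOTSum (fun p => (W.krausTerm k p).adjoint) (W.kraus k).adjoint := by
  obtain ⟨S, hS⟩ := exists_hasSOTSum_of_orthogonal (W.norm_krausTerm_le k)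
    (W.krausTerm_comp_adjoint hk) (W.krausTerm_adjoint_comp hk)
  have h : W.kraus k = S := hS.sotSum_eq
  rw [h]
  exact hS.adjoint_of_orthogonal (W.norm_krausTerm_le k)
    (W.krausTerm_comp_adjoint hk) (W.krausTerm_adjoint_comp hk)

/-! ### The values of the transition expectation -/

/-- `√(w j) a M^i_j`. -/
def weightedTerm (a : HTensor H K →L[ℂ] HTensor H K) (w : Λ → ℝ≥0) (p : Λ × Λ) :
    HTensor H K →L[ℂ] HTensor H K :=
  ((√(w p.2) : ℝ) : ℂ) • (a ∘L W.M p.1 p.2)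

/-- `∑_{i,j} w_j (M^i_j)* a M^i_j` for a projection `a`. -/
def weighted (a : HTensor H K →L[ℂ] HTensor H K) (w : Λ → ℝ≥0) :
    HTensor H K →L[ℂ] HTensor H K :=
  sotSum fun p => (W.weightedTerm a w p).adjoint ∘L W.weightedTerm a w p

theorem weightedTerm_apply (a : HTensor H K →L[ℂ] HTensor H K) (w : Λ → ℝ≥0) (p : Λ × Λ)
    (x : HTensor H K) :
    W.weightedTerm a w p x = ((√(w p.2) : ℝ) : ℂ) • a (W.M p.1 p.2 x) := rfl

theorem enorm_weightedTerm (a : HTensor H K →L[ℂ] HTensor H K) (w : Λ → ℝ≥0) (p : Λ × Λ)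
    (x : HTensor H K) :
    ‖W.weightedTerm a w p x‖ₑ ^ 2 = w p.2 * ‖a (W.M p.1 p.2 x)‖ₑ ^ 2 := by
  rw [weightedTerm_apply, enorm_smul, mul_pow]
  congr 1
  rw [← ofReal_norm_sq, Complex.norm_real, Real.norm_eq_abs, sq_abs,
    Real.sq_sqrt (NNReal.coe_nonneg _), ENNReal.ofReal_coe_nnreal]

/-- This is ∑ (M^i_j)* M^i_j = 1: on each sector it is the normalization of B, and the sectors span
H ⊗ K. -/
theorem tsum_enorm_M (x : HTensor H K) : ∑' p : Λ × Λ, ‖W.M p.1 p.2 x‖ₑ ^ 2 = ‖x‖ₑ ^ 2 := by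
  rw [ENNReal.tsum_prod' (f := fun p : Λ × Λ => ‖W.M p.1 p.2 x‖ₑ ^ 2), ENNReal.tsum_comm,
    ← W.tsum_enorm_sector_adjoint x]
  refine tsum_congr fun j => ?_
  rw [← W.tsum_enorm_B j]
  refine tsum_congr fun i => ?_
  rw [M_apply, enorm_sector]

variable {a : HTensor H K →L[ℂ] HTensor H K} {w : Λ → ℝ≥0}

theorem hasSOTSum_weighted (ha : IsStarProjection a) (hw : ∀ j, w j ≤ 1) :
    HasSOTSum (fun p => (W.weightedTerm a w p).adjoint ∘L W.weightedTerm a w p)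
      (W.weighted a w) := by
  obtain ⟨Z, -, hZ⟩ := exists_hasSOTSum_adjoint_comp (W.weightedTerm a w) 1 fun x => by
    rw [ENNReal.coe_one, one_mul, ← W.tsum_enorm_M x]
    refine ENNReal.tsum_le_tsum fun p => ?_
    rw [enorm_weightedTerm, ← one_mul (‖W.M p.1 p.2 x‖ₑ ^ 2)]
    exact mul_le_mul' (by exact_mod_cast hw p.2) (enorm_apply_le_of_isStarProjection ha _)
  rw [weighted, hZ.sotSum_eq]
  exact hZ

theorem weighted_nonneg (ha : IsStarProjection a) (hw : ∀ j, w j ≤ 1) : 0 ≤ W.weighted a w :=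
  (W.hasSOTSum_weighted ha hw).nonneg

theorem quadForm_weighted (ha : IsStarProjection a) (hw : ∀ j, w j ≤ 1) (x : HTensor H K) :
    quadForm (W.weighted a w) x = ∑' p : Λ × Λ, w p.2 * ‖a (W.M p.1 p.2 x)‖ₑ ^ 2 := by
  rw [(W.hasSOTSum_weighted ha hw).quadForm_eq]
  simp_rw [enorm_weightedTerm]

theorem weighted_one_one : W.weighted 1 (fun _ => 1) = 1 := by
  refine eq_of_quadForm_eq (W.weighted_nonneg isStarProjection_one fun _ => le_rfl) zero_le_one
    fun x => ?_
  rw [W.quadForm_weighted isStarProjection_one fun _ => le_rfl, quadForm_one, ← W.tsum_enorm_M]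
  simp

theorem weighted_add (ha : IsStarProjection a) {w w' : Λ → ℝ≥0} (hw : ∀ j, w j + w' j ≤ 1) :
    W.weighted a w + W.weighted a w' = W.weighted a fun j => w j + w' j := by
  have h1 (j : Λ) : w j ≤ 1 := le_self_add.trans (hw j)
  have h2 (j : Λ) : w' j ≤ 1 := le_add_self.trans (hw j)
  have h3 := W.weighted_nonneg ha h1
  have h4 := W.weighted_nonneg ha h2
  refine eq_of_quadForm_eq (add_nonneg h3 h4) (W.weighted_nonneg ha hw) fun x => ?_
  rw [quadForm_add h3 h4, W.quadForm_weighted ha h1, W.quadForm_weighted ha h2,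
    W.quadForm_weighted ha hw, ← ENNReal.tsum_add]
  refine tsum_congr fun p => ?_
  rw [ENNReal.coe_add, add_mul]

theorem weighted_le (ha : IsStarProjection a) (hw : ∀ j, w j ≤ 1) {c : ℝ} (hc : 0 ≤ c)
    (hwc : ∀ j, (w j : ℝ) ≤ c) : W.weighted a w ≤ (c : ℂ) • 1 := by
  refine le_smul_one_of_quadForm_le (W.weighted_nonneg ha hw) hc fun x => ?_
  rw [W.quadForm_weighted ha hw, ← W.tsum_enorm_M, ← ENNReal.tsum_mul_left]
  refine ENNReal.tsum_le_tsum fun p => ?_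
  refine mul_le_mul' ?_ (enorm_apply_le_of_isStarProjection ha _)
  rw [← ENNReal.ofReal_coe_nnreal]
  exact ENNReal.ofReal_le_ofReal (hwc _)

theorem norm_weighted_le (ha : IsStarProjection a) (hw : ∀ j, w j ≤ 1) {c : ℝ} (hc : 0 ≤ c)
    (hwc : ∀ j, (w j : ℝ) ≤ c) : ‖W.weighted a w‖ ≤ c :=
  norm_le_of_le_smul_one (W.weighted_nonneg ha hw) hc (W.weighted_le ha hw hc hwc)

/-- The matrix elements of `b` between different sectors vanish. -/
def IsBlockDiagonal (b : HTensor H K →L[ℂ] HTensor H K) : Prop :=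
  ∀ i j, i ≠ j → ∀ h h', ⟪W.sector i h, b (W.sector j h')⟫_ℂ = 0

theorem isBlockDiagonal_one : W.IsBlockDiagonal 1 := by
  intro i j hij h h'
  refine (W.inner_sector i j h h').trans ?_
  rw [W.basis.orthonormal.inner_eq_zero hij, mul_zero]

/-- Each M^m_n is supported on the single sector n, so no summand links two sectors. This lets the
output of `transition` be fed back into it. -/
theorem isBlockDiagonal_weighted (ha : IsStarProjection a) (hw : ∀ j, w j ≤ 1) :
    W.IsBlockDiagonal (W.weighted a w) := by
  intro i j hij h h'
  rw [← ((W.hasSOTSum_weighted ha hw).hasSum_inner _ _).tsum_eq]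
  refine (tsum_congr ?_).trans tsum_zero
  rintro ⟨m, n⟩
  by_cases hn : n = i
  · have hnj : n ≠ j := fun h => hij (hn.symm.trans h)
    simp [weightedTerm_apply, M_apply, W.sector_adjoint_sector_of_ne hnj]
  · simp [weightedTerm_apply, M_apply, W.sector_adjoint_sector_of_ne hn]

/-- `Tr ((Tr(ρ_j)⁻¹ ρ_j ⊗ |j⟩⟨j|) b)`, for `b ≥ 0`. -/
def blockState (j : Λ) (b : HTensor H K →L[ℂ] HTensor H K) : ℝ≥0∞ :=
  ∑' h, quadForm b (W.sector j (W.sqrtState j (stdBasis H h)))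

/-- The value of `ψ_j` at a projection `f`, in `[0, ∞]`. -/
def stepState (j : Λ) (f : HTensor H K →L[ℂ] HTensor H K) : ℝ≥0∞ :=
  ∑' i, ∑' h, ‖f (W.sector i (W.B i j (W.sqrtState j (stdBasis H h))))‖ₑ ^ 2

theorem blockState_one (j : Λ) : W.blockState j 1 = 1 := by
  rw [blockState, ← W.tsum_enorm_sqrtState j]
  simp_rw [quadForm_one, enorm_sector]

/-- Only the operators M^i_j act on sector j, so the weight w_j factors out: the source of
multiplicativity along a ray. -/
theorem blockState_weighted (ha : IsStarProjection a) (hw : ∀ j, w j ≤ 1) (j : Λ) :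
    W.blockState j (W.weighted a w) = w j * W.stepState j a := by
  rw [blockState, stepState, ENNReal.tsum_comm, ← ENNReal.tsum_mul_left]
  refine tsum_congr fun h => ?_
  rw [W.quadForm_weighted ha hw, ENNReal.tsum_prod', ← ENNReal.tsum_mul_left]
  refine tsum_congr fun i => ?_
  rw [tsum_eq_single j]
  · rw [M_apply, sector_adjoint_sector]
  · intro m hm
    rw [M_apply, W.sector_adjoint_sector_of_ne hm]
    simp

theorem tsum_tsum_enorm_B (j : Λ) :
    ∑' i, ∑' h, ‖W.B i j (W.sqrtState j (stdBasis H h))‖ₑ ^ 2 = 1 := by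
  rw [ENNReal.tsum_comm, ← W.tsum_enorm_sqrtState j]
  simp_rw [tsum_enorm_B]

theorem stepState_one (j : Λ) : W.stepState j 1 = 1 := by
  rw [stepState, ← W.tsum_tsum_enorm_B j]
  refine tsum_congr fun i => tsum_congr fun h => ?_
  exact congrArg (· ^ 2) (W.enorm_sector i _)

theorem stepState_add_compl (ha : IsStarProjection a) (j : Λ) :
    W.stepState j a + W.stepState j (1 - a) = 1 := by
  rw [← W.stepState_one j, stepState, stepState, stepState, ← ENNReal.tsum_add]
  refine tsum_congr fun i => ?_
  rw [← ENNReal.tsum_add]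
  refine tsum_congr fun h => ?_
  rw [enorm_sq_add_of_isStarProjection ha]
  rfl

theorem stepState_le_one (ha : IsStarProjection a) (j : Λ) : W.stepState j a ≤ 1 :=
  W.stepState_add_compl ha j ▸ le_self_add

/-- With `N` = |i⟩-sector ∘ B^i_j ∘ (Tr ρ_j)^{-1/2} ρ_j^{1/2}, the operator in the trace is Tr(ρ_j)
N N* a, and Tr(N N* a) = Tr(N* a N) is the sum of the ‖a N h‖² over a basis. -/
theorem ψ_eq (ha : IsStarProjection a) (j : Λ) : W.ψ j a = ((W.stepState j a).toReal : ℂ) := by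
  have hfin (i : Λ) : ∑' h, ‖a (W.sector i (W.B i j (W.sqrtState j (stdBasis H h))))‖ₑ ^ 2 ≠ ∞ :=
    ne_top_of_le_ne_top ENNReal.one_ne_top ((ENNReal.le_tsum i).trans (W.stepState_le_one ha j))
  have hfin' (i : Λ) : ∑' h, ‖W.sector i (W.B i j (W.sqrtState j (stdBasis H h)))‖ₑ ^ 2 ≠ ∞ := by
    refine ne_top_of_le_ne_top ENNReal.one_ne_top (le_trans ?_ (W.tsum_tsum_enorm_B j).le)
    simp_rw [enorm_sector]
    exact ENNReal.le_tsum (f := fun i => ∑' h, ‖W.B i j (W.sqrtState j (stdBasis H h))‖ₑ ^ 2) i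
  have htr (i : Λ) : trace (opTmul (W.B i j ∘L W.ρ j ∘L (W.B i j).adjoint) (W.ketBra i i) ∘L a) =
      (W.trρ j : ℂ) * ((∑' h,
        ‖a (W.sector i (W.B i j (W.sqrtState j (stdBasis H h))))‖ₑ ^ 2).toReal : ℂ) := by
    set N : H →L[ℂ] HTensor H K := W.sector i ∘L W.B i j ∘L W.sqrtState j with hN
    have h1 (x : HTensor H K) :
        ⟪x, (opTmul (W.B i j ∘L W.ρ j ∘L (W.B i j).adjoint) (W.ketBra i i) ∘L a) x⟫_ℂ =
          (W.trρ j : ℂ) * ⟪N.adjoint x, (a ∘L N).adjoint x⟫_ℂ := by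
      have ha' : a.adjoint = a := ha.isSelfAdjoint
      have h0 (y : HTensor H K) : opTmul (W.B i j ∘L W.ρ j ∘L (W.B i j).adjoint) (W.ketBra i i) y =
          (W.trρ j : ℂ) • N (N.adjoint y) := by
        rw [opTmul_ketBra, ρ_eq, hN, ContinuousLinearMap.adjoint_comp,
          ContinuousLinearMap.adjoint_comp, sqrtState_adjoint]
        simp only [ContinuousLinearMap.comp_apply, smul_apply, map_smul]
      rw [ContinuousLinearMap.comp_apply, h0, inner_smul_right,
        ContinuousLinearMap.adjoint_comp a N, ha', ContinuousLinearMap.adjoint_inner_left]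
      rfl
    rw [trace]
    simp_rw [h1]
    rw [tsum_mul_left, tsum_inner_adjoint_comm (stdBasis H) _ N (a ∘L N) (hfin' i) (hfin i),
      ENNReal.tsum_toReal_eq (fun h => by finiteness), Complex.ofReal_tsum]
    congr 1
    refine tsum_congr fun h => ?_
    have ha' : a.adjoint ∘L a = a := adjoint_comp_self_of_isStarProjection ha
    have h2 (x : HTensor H K) : ⟪a x, x⟫_ℂ = ((‖a x‖ ^ 2 : ℝ) : ℂ) := by
      conv_lhs => rw [← ha']
      rw [ContinuousLinearMap.comp_apply, ContinuousLinearMap.adjoint_inner_left,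
        inner_self_eq_norm_sq_to_K]
      simp
    rw [ENNReal.toReal_pow, toReal_enorm]
    exact h2 _
  rw [ψ]
  simp_rw [htr]
  rw [tsum_mul_left, ← mul_assoc, ← Complex.ofReal_mul, one_div,
    inv_mul_cancel₀ (W.trρ_pos j).ne', Complex.ofReal_one, one_mul, ← Complex.ofReal_tsum,
    ← ENNReal.tsum_toReal_eq hfin]
  rfl

variable {k : ℕ}

theorem A_adjoint_apply (i j : Λ) (y : HTensor H K) :
    (W.A i j).adjoint y = W.sector j (W.sqrtState j ((W.sector i).adjoint y)) := by
  rw [A_eq, ContinuousLinearMap.adjoint_comp, ContinuousLinearMap.adjoint_comp,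
    ContinuousLinearMap.adjoint_adjoint, sqrtState_adjoint]
  rfl

theorem A_adjoint_prodBasis (p : Λ × Λ) (h : BasisIndex H × Λ) :
    (h.2 = p.1 → (W.A p.1 p.2).adjoint (prodBasis (stdBasis H) W.basis h) =
      W.sector p.2 (W.sqrtState p.2 (stdBasis H h.1))) ∧
    (h.2 ≠ p.1 → (W.A p.1 p.2).adjoint (prodBasis (stdBasis H) W.basis h) = 0) := by
  rw [A_adjoint_apply, prodBasis_apply, ← sector_apply]
  constructor
  · intro hp
    rw [hp, sector_adjoint_sector]
  · intro hp
    rw [W.sector_adjoint_sector_of_ne (Ne.symm hp), map_zero, map_zero]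

theorem tsum_enorm_A_adjoint (c : HTensor H K →L[ℂ] HTensor H K) (p : Λ × Λ) :
    ∑' h, ‖c ((W.A p.1 p.2).adjoint (prodBasis (stdBasis H) W.basis h))‖ₑ ^ 2 =
      W.blockState p.2 (c.adjoint ∘L c) := by
  rw [ENNReal.tsum_prod', blockState]
  refine tsum_congr fun h => ?_
  rw [tsum_eq_single p.1]
  · rw [(W.A_adjoint_prodBasis p (h, p.1)).1 rfl, quadForm_adjoint_comp]
  · intro i hi
    rw [(W.A_adjoint_prodBasis p (h, i)).2 hi]
    simp

/-- The summand `(i, j)` of `(a ⊗ c₁ ⊗ ⋯ ⊗ c_k) K* (x ⊗ β₁ ⊗ ⋯ ⊗ β_k)`. -/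
def rotatedTerm (a : HTensor H K →L[ℂ] HTensor H K) (c : Fin k → HTensor H K →L[ℂ] HTensor H K)
    (x : HTensor H K) (β : Fin k → BasisIndex H × Λ) (p : Λ × Λ) :
    (vertexSpace (HTensor H K) k).carrier :=
  tensorRight k
    (fun l => c l ((W.A p.1 p.2).adjoint (prodBasis (stdBasis H) W.basis (β l))))
    (a (W.M p.1 p.2 x))

theorem hasSum_rotatedTerm (hk : 1 ≤ k) (a : HTensor H K →L[ℂ] HTensor H K)
    (c : Fin k → HTensor H K →L[ℂ] HTensor H K) (x : HTensor H K)
    (β : Fin k → BasisIndex H × Λ) :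
    HasSum (W.rotatedTerm a c x β) ((opTensor k a c ∘L (W.kraus k).adjoint)
      (tensorRight k (fun l => prodBasis (stdBasis H) W.basis (β l)) x)) := by
  have h := (W.hasSOTSum_kraus_adjoint hk
    (tensorRight k (fun l => prodBasis (stdBasis H) W.basis (β l)) x)).mapL (opTensor k a c)
  have h2 : W.rotatedTerm a c x β = fun p => opTensor k a c ((W.krausTerm k p).adjoint
      (tensorRight k (fun l => prodBasis (stdBasis H) W.basis (β l)) x)) := funext fun p => by
    rw [krausTerm_adjoint, opTensor_tensorRight, opTensor_tensorRight]
    rfl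
  rw [h2]
  exact h

/-- A single successor suffices. A basis vector lies in one sector, which excludes different i;
block diagonality of c* c excludes different j. -/
theorem inner_rotatedTerm_of_ne (hk : 1 ≤ k) (a : HTensor H K →L[ℂ] HTensor H K)
    {c : Fin k → HTensor H K →L[ℂ] HTensor H K}
    (hc : ∀ l, W.IsBlockDiagonal ((c l).adjoint ∘L c l)) (x : HTensor H K)
    (β : Fin k → BasisIndex H × Λ) (p q : Λ × Λ) (hpq : p ≠ q) :
    ⟪W.rotatedTerm a c x β p, W.rotatedTerm a c x β q⟫_ℂ = 0 := by
  rw [rotatedTerm, rotatedTerm, inner_tensorRight]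
  refine mul_eq_zero_of_right _ (Finset.prod_eq_zero (Finset.mem_univ (⟨0, hk⟩ : Fin k)) ?_)
  by_cases h : p.2 = q.2
  · have h' : p.1 ≠ q.1 := fun h' => hpq (Prod.ext h' h)
    by_cases hp : (β ⟨0, hk⟩).2 = p.1
    · rw [(W.A_adjoint_prodBasis q (β ⟨0, hk⟩)).2 (hp ▸ h'), map_zero, inner_zero_right]
    · rw [(W.A_adjoint_prodBasis p (β ⟨0, hk⟩)).2 hp, map_zero, inner_zero_left]
  · have h2 := hc ⟨0, hk⟩ p.2 q.2 h
      (W.sqrtState p.2 ((W.sector p.1).adjoint (prodBasis (stdBasis H) W.basis (β ⟨0, hk⟩))))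
      (W.sqrtState q.2 ((W.sector q.1).adjoint (prodBasis (stdBasis H) W.basis (β ⟨0, hk⟩))))
    rw [ContinuousLinearMap.comp_apply, ContinuousLinearMap.adjoint_inner_right] at h2
    rw [A_adjoint_apply, A_adjoint_apply]
    exact h2

/-- In the basis adapted to the sectors the terms of K* are orthogonal, so Pythagoras removes the
cross terms. What remains is a sum over tuples that factors over the successors. -/
theorem tsum_enorm_kraus (hk : 1 ≤ k) (a : HTensor H K →L[ℂ] HTensor H K)
    {c : Fin k → HTensor H K →L[ℂ] HTensor H K}
    (hc : ∀ l, W.IsBlockDiagonal ((c l).adjoint ∘L c l)) (x : HTensor H K) :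
    ∑' β : Fin k → BasisIndex (HTensor H K), ‖(opTensor k a c ∘L (W.kraus k).adjoint)
      (tensorRight k (fun l => stdBasis (HTensor H K) (β l)) x)‖ₑ ^ 2 =
    ∑' p : Λ × Λ, (∏ l, W.blockState p.2 ((c l).adjoint ∘L c l)) * ‖a (W.M p.1 p.2 x)‖ₑ ^ 2 := by
  rw [tsum_enorm_sq_tensorRight_basis_indep _ (prodBasis (stdBasis H) W.basis)]
  have h1 (β : Fin k → BasisIndex H × Λ) := enorm_sq_of_hasSum_orthogonal
    (W.hasSum_rotatedTerm hk a c x β) (W.inner_rotatedTerm_of_ne hk a hc x β)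
  simp_rw [h1]
  rw [ENNReal.tsum_comm]
  refine tsum_congr fun p => ?_
  simp_rw [rotatedTerm, enorm_tensorRight, mul_pow, ← Finset.prod_pow]
  rw [ENNReal.tsum_mul_left, mul_comm]
  congr 1
  rw [tsum_prod_pi k fun l h =>
    ‖c l ((W.A p.1 p.2).adjoint (prodBasis (stdBasis H) W.basis h))‖ₑ ^ 2]
  simp_rw [tsum_enorm_A_adjoint]

/-- `𝓔(a ⊗ b₁ ⊗ ⋯ ⊗ b_k)` for a projection `a` and positive block diagonal operators `b_l`. -/
theorem transition_opTensor (hk : 1 ≤ k) (ha : IsStarProjection a)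
    {b : Fin k → HTensor H K →L[ℂ] HTensor H K} (hb : ∀ l, 0 ≤ b l)
    (hbd : ∀ l, W.IsBlockDiagonal (b l)) {w : Λ → ℝ≥0} (hw1 : ∀ j, w j ≤ 1)
    (hw : ∀ j, ∏ l, W.blockState j (b l) = w j) :
    W.transition k (opTensor k a b) = W.weighted a w := by
  -- Writing b_l = c_l* c_l exhibits each summand of the partial trace as R* R, so that only norms
  -- have to be computed.
  choose c hc using fun l => exists_eq_adjoint_comp (hb l)
  obtain rfl : b = fun l => (c l).adjoint ∘L c l := funext hc
  have h1 : opTensor k a (fun l => (c l).adjoint ∘L c l) =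
      (opTensor k a c).adjoint ∘L opTensor k a c := by
    rw [opTensor_adjoint, opTensor_comp, adjoint_comp_self_of_isStarProjection ha]
  let R (β : Fin k → BasisIndex (HTensor H K)) :=
    (opTensor k a c ∘L (W.kraus k).adjoint) ∘L
      tensorRight k (fun l => stdBasis (HTensor H K) (β l))
  have h2 : HasSOTSum (fun β => (R β).adjoint ∘L R β) (W.weighted a w) := by
    refine hasSOTSum_of_quadForm_eq (W.weighted_nonneg ha hw1) fun x => ?_
    rw [W.quadForm_weighted ha hw1]
    refine (W.tsum_enorm_kraus hk a hbd x).trans ?_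
    simp_rw [hw]
  rw [← h2.sotSum_eq, transition, partialTrace, h1]
  congr 1
  funext β
  simp only [R, ContinuousLinearMap.adjoint_comp, ContinuousLinearMap.adjoint_adjoint,
    ContinuousLinearMap.comp_assoc]

/-! ### Product observables supported on a ray -/

/-- `ψ_j(f)` for a projection `f`, as a non-negative real number. -/
def stepProb (f : HTensor H K →L[ℂ] HTensor H K) (j : Λ) : ℝ≥0 := (W.stepState j f).toNNReal

theorem coe_stepProb (ha : IsStarProjection a) (j : Λ) :
    (W.stepProb a j : ℝ≥0∞) = W.stepState j a :=
  ENNReal.coe_toNNReal (ne_top_of_le_ne_top ENNReal.one_ne_top (W.stepState_le_one ha j))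

theorem stepProb_le_one (ha : IsStarProjection a) (j : Λ) : W.stepProb a j ≤ 1 := by
  have := W.stepState_le_one ha j
  rw [← W.coe_stepProb ha] at this
  exact_mod_cast this

theorem stepProb_add_compl (ha : IsStarProjection a) (j : Λ) :
    W.stepProb a j + W.stepProb (1 - a) j = 1 := by
  have := W.stepState_add_compl ha j
  rw [← W.coe_stepProb ha, ← W.coe_stepProb (isStarProjection_compl ha)] at this
  exact_mod_cast this

theorem transition_one (hk : 1 ≤ k) (ha : IsStarProjection a) :
    W.transition k (opTensor k a fun _ => 1) = W.weighted a fun _ => 1 :=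
  W.transition_opTensor hk ha (fun _ => zero_le_one) (fun _ => W.isBlockDiagonal_one)
    (fun _ => le_rfl) fun j => by simp [blockState_one]

section RayObservable

variable {b : ProdObs k (HTensor H K)} {r : Ray k} {f : ℕ → HTensor H K →L[ℂ] HTensor H K}

/-- The successors of a vertex off the ray are off the ray, and 𝓔(1) = 1. -/
theorem iterate_of_off_ray (hk : 1 ≤ k) (hoff : ∀ u, (∀ n, u ≠ r.x n) → b u = 1) (m : ℕ) :
    ∀ u, (∀ n, u ≠ r.x n) → W.iterate b m u = 1 := by
  induction m with
  | zero => exact fun _ _ => rfl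
  | succ m ih =>
    intro u hu
    have hu' (l : Fin k) (n : ℕ) : u ++ [l] ≠ r.x n := by
      intro h
      cases n with
      | zero => simp [r.root] at h
      | succ n =>
        obtain ⟨l', hl'⟩ := r.succ n
        rw [hl'] at h
        exact hu n (List.append_inj_left' h rfl)
    have h1 : W.iterate b (m + 1) u =
      W.transition k (opTensor k (b u) fun l => W.iterate b m (u ++ [l])) := rfl
    rw [h1, hoff u hu, funext fun l => ih (u ++ [l]) (hu' l),
      W.transition_one hk isStarProjection_one, weighted_one_one]

/-- Exactly one successor of x_d lies on the ray; the others contribute 1. The product starts at d +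
1 because the factor at x_d stays inside the operator. The level d is arbitrary since the induction
on depth moves to x_{d+1}. -/
theorem iterate_ray (hk : 1 ≤ k) (hf : ∀ n, IsStarProjection (f n)) (hon : ∀ n, b (r.x n) = f n)
    (hoff : ∀ u, (∀ n, u ≠ r.x n) → b u = 1) (m : ℕ) :
    ∀ d, W.iterate b (m + 1) (r.x d) =
      W.weighted (f d) fun j => ∏ t ∈ Finset.range m, W.stepProb (f (d + 1 + t)) j := by
  have hw (m d : ℕ) (j : Λ) : ∏ t ∈ Finset.range m, W.stepProb (f (d + 1 + t)) j ≤ 1 :=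
    Finset.prod_le_one' fun t _ => W.stepProb_le_one (hf _) j
  have hstep (m d : ℕ) : W.iterate b (m + 1) (r.x d) =
      W.transition k (opTensor k (f d) fun l => W.iterate b m (r.x d ++ [l])) := by
    rw [← hon]; rfl
  induction m with
  | zero =>
    intro d
    rw [hstep]
    exact W.transition_one hk (hf d)
  | succ m ih =>
    intro d
    obtain ⟨l₀, hl₀⟩ := r.succ d
    have hne (l : Fin k) (hl : l ≠ l₀) : W.iterate b (m + 1) (r.x d ++ [l]) = 1 := by
      refine W.iterate_of_off_ray hk hoff _ _ fun n hn => hl ?_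
      have h1 := congrArg List.length hn
      rw [List.length_append, r.length_x, r.length_x] at h1
      obtain rfl : d + 1 = n := h1
      rw [hl₀] at hn
      simpa using hn
    have heq : W.iterate b (m + 1) (r.x d ++ [l₀]) = W.weighted (f (d + 1))
        fun j => ∏ t ∈ Finset.range m, W.stepProb (f (d + 1 + 1 + t)) j := by
      rw [← hl₀, ih (d + 1)]
    rw [hstep]
    refine W.transition_opTensor hk (hf d) (fun l => ?_) (fun l => ?_) (hw _ _) fun j => ?_
    · by_cases hl : l = l₀
      · rw [hl, heq]; exact W.weighted_nonneg (hf _) (hw _ _)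
      · rw [hne l hl]; exact zero_le_one
    · by_cases hl : l = l₀
      · rw [hl, heq]; exact W.isBlockDiagonal_weighted (hf _) (hw _ _)
      · rw [hne l hl]; exact W.isBlockDiagonal_one
    -- The product over successors collapses to l₀. Its block state supplies ψ_j at level d + 1,
    -- which is the t = 0 factor split off by `Finset.prod_range_succ'`.
    · rw [Finset.prod_eq_single l₀ (fun l _ hl => by rw [hne l hl, blockState_one])
        (fun h => absurd (Finset.mem_univ _) h), heq, W.blockState_weighted (hf _) (hw _ _),
        ← W.coe_stepProb (hf _), ← ENNReal.coe_mul, Finset.prod_range_succ']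
      simp only [add_zero, add_assoc, add_comm 1]

end RayObservable

variable {e : HTensor H K →L[ℂ] HTensor H K}

/-- There are n + 1 factors e^⊥, but the one at the root is not evaluated by ψ_j; hence the exponent
n. -/
theorem condExp_tauInf (hk : 1 ≤ k) (he : IsStarProjection e) (r : Ray k) (n : ℕ) :
    W.condExp n (tauInf e r n) = W.weighted (1 - e) fun j => W.stepProb (1 - e) j ^ n := by
  have h := W.iterate_ray (b := tauInf e r n) (r := r)
    (f := fun t => if t ≤ n then 1 - e else 1) hk
    (fun t => by
      split_ifs
      exacts [(isStarProjection_compl he), isStarProjection_one])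
    (fun t => by
      have : (∃ m ≤ n, r.x t = r.x m) ↔ t ≤ n :=
        ⟨fun ⟨m, hm, h⟩ => r.x_injective h ▸ hm, fun h => ⟨t, h, rfl⟩⟩
      simp only [tauInf, this])
    (fun u hu => if_neg fun ⟨m, _, h⟩ => hu m h) n 0
  rw [r.root] at h
  rw [condExp, h]
  simp only [Nat.zero_le, if_true]
  congr 1
  funext j
  rw [Finset.prod_congr rfl (g := fun _ => W.stepProb (1 - e) j), Finset.prod_const,
    Finset.card_range]
  intro t ht
  rw [if_pos (by have := Finset.mem_range.1 ht; omega)]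

/-- The observable is carried by the shifted ray: e at the root, then n factors e^⊥ and a final e,
all of which enter the weight. -/
theorem condExp_rootTensor_tau (hk : 1 ≤ k) (he : IsStarProjection e) (r : Ray k) (l : Fin k)
    (n : ℕ) : W.condExp (n + 1) (rootTensor e l (tau e r n)) =
      W.weighted e fun j => W.stepProb (1 - e) j ^ n * W.stepProb e j := by
  have h := W.iterate_ray (b := rootTensor e l (tau e r n)) (r := r.shift l)
    (f := fun
      | 0 => e
      | t + 1 => if t = n then e else if t < n then 1 - e else 1) hk
    (fun t => by
      cases t with
      | zero => exact he
      | succ t =>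
        dsimp only
        split_ifs
        exacts [he, (isStarProjection_compl he), isStarProjection_one])
    (fun t => by
      cases t with
      | zero => rfl
      | succ t =>
        have h1 : (∃ m < n, r.x t = r.x m) ↔ t < n :=
          ⟨fun ⟨m, hm, h⟩ => r.x_injective h ▸ hm, fun h => ⟨t, h, rfl⟩⟩
        have h2 : r.x t = r.x n ↔ t = n := (r.x_injective).eq_iff
        simp only [Ray.shift, rootTensor, tau, h1, h2, if_true])
    (fun u hu => by
      cases u with
      | nil => exact absurd rfl (hu 0)
      | cons i u =>
        simp only [rootTensor]
        split_ifs with hi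
        · subst hi
          have hu' (m : ℕ) : u ≠ r.x m := fun h => hu (m + 1) (by simp [Ray.shift, h])
          rw [tau, if_neg (hu' n), if_neg fun ⟨m, _, h⟩ => hu' m h]
        · rfl) (n + 1) 0
  rw [(r.shift l).root] at h
  rw [condExp, h]
  congr 1
  funext j
  simp only [zero_add, Nat.add_comm 1]
  rw [Finset.prod_range_succ, if_pos rfl,
    Finset.prod_congr rfl (g := fun _ => W.stepProb (1 - e) j), Finset.prod_const,
    Finset.card_range]
  intro t ht
  have := Finset.mem_range.1 ht
  rw [if_neg (by omega), if_pos this]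

/-! ### Recurrence -/

/-- With q_j = ψ_j(e^⊥) and ψ_j(e) = 1 - q_j, the weights q_j^n - q_j^{n+1} telescope. The uniform
bound q_j ≤ p < 1 sends the remainder to 0 in norm. -/
theorem hasSOTSum_weighted_geometric (he : IsStarProjection e) {p : ℝ} (hp0 : 0 ≤ p) (hp1 : p < 1)
    (hp : ∀ j, (W.stepProb (1 - e) j : ℝ) ≤ p) :
    HasSOTSum (fun n : ℕ => W.weighted e fun j => W.stepProb (1 - e) j ^ n * W.stepProb e j)
      (W.weighted e fun _ => 1) := by
  intro x
  have hq (n : ℕ) (j : Λ) : W.stepProb (1 - e) j ^ n ≤ 1 :=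
    pow_le_one' (W.stepProb_le_one (isStarProjection_compl he) j) n
  have hsum (n : ℕ) (j : Λ) : W.stepProb (1 - e) j ^ n * W.stepProb e j +
      W.stepProb (1 - e) j ^ (n + 1) = W.stepProb (1 - e) j ^ n := by
    rw [pow_succ, ← mul_add, W.stepProb_add_compl he, mul_one]
  have hqs (n : ℕ) (j : Λ) :
      W.stepProb (1 - e) j ^ n * W.stepProb e j ≤ W.stepProb (1 - e) j ^ n :=
    mul_le_of_le_one_right' (W.stepProb_le_one he j)
  have hqp (n : ℕ) (j : Λ) : ((W.stepProb (1 - e) j ^ n : ℝ≥0) : ℝ) ≤ p ^ n := by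
    rw [NNReal.coe_pow]
    exact pow_le_pow_left₀ (NNReal.coe_nonneg _) (hp j) n
  set Y : ℕ → HTensor H K →L[ℂ] HTensor H K :=
    fun n => W.weighted e fun j => W.stepProb (1 - e) j ^ n with hY
  have htel (n : ℕ) : (W.weighted e fun j => W.stepProb (1 - e) j ^ n * W.stepProb e j) =
      Y n - Y (n + 1) := by
    rw [eq_sub_iff_add_eq, hY, W.weighted_add he fun j => (hsum n j).trans_le (hq n j)]
    simp_rw [hsum]
  have hpow : Tendsto (fun n : ℕ => p ^ n * ‖x‖) atTop (𝓝 0) := by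
    simpa using (tendsto_pow_atTop_nhds_zero_of_lt_one hp0 hp1).mul_const ‖x‖
  have hYx : Tendsto (fun n => Y n x) atTop (𝓝 0) := by
    refine squeeze_zero_norm (fun n => ?_) hpow
    exact ((Y n).le_opNorm x).trans (by
      gcongr
      exact W.norm_weighted_le he (hq n) (by positivity) (hqp n))
  -- `HasSOTSum` is unconditional, so convergence of partial sums is not enough; domination by the
  -- series of p^n ‖x‖ gives summability.
  have hsummable : Summable fun n : ℕ =>
      (W.weighted e fun j => W.stepProb (1 - e) j ^ n * W.stepProb e j) x := by
    refine Summable.of_norm_bounded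
      ((summable_geometric_of_lt_one hp0 hp1).mul_right ‖x‖) fun n => ?_
    refine (ContinuousLinearMap.le_opNorm _ x).trans ?_
    gcongr
    exact W.norm_weighted_le he (fun j => (hqs n j).trans (hq n j)) (by positivity)
      fun j => le_trans (NNReal.coe_le_coe.2 (hqs n j)) (hqp n j)
  rw [hsummable.hasSum_iff_tendsto_nat]
  have hpart (N : ℕ) : ∑ n ∈ Finset.range N,
      (W.weighted e fun j => W.stepProb (1 - e) j ^ n * W.stepProb e j) x = Y 0 x - Y N x := by
    rw [← Finset.sum_range_sub' (fun n => Y n x)]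
    refine Finset.sum_congr rfl fun n _ => ?_
    rw [htel]
    rfl
  simp_rw [hpart]
  have hY0 : (W.weighted e fun _ => 1) = Y 0 := by simp [hY]
  rw [hY0]
  simpa using hYx.const_sub (Y 0 x)

theorem nonempty_index (W : OQRW H K Λ) : Nonempty Λ := by
  by_contra h
  rw [not_nonempty_iff] at h
  simpa using W.trace_ρ

theorem ψ_compl_re (he : IsStarProjection e) (j : Λ) :
    (W.ψ j (1 - e)).re = W.stepProb (1 - e) j := by
  rw [W.ψ_eq (isStarProjection_compl he), Complex.ofReal_re]
  rfl

theorem stepProb_compl_le (he : IsStarProjection e) (j : Λ) :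
    (W.stepProb (1 - e) j : ℝ) ≤ ⨆ j, (W.ψ j (1 - e)).re := by
  rw [← W.ψ_compl_re he]
  -- Boundedness above by 1 must be supplied: a real supremum of an unbounded family would be 0 by
  -- default.
  refine le_ciSup (f := fun j => (W.ψ j (1 - e)).re) ⟨1, ?_⟩ j
  rintro _ ⟨i, rfl⟩
  dsimp only
  rw [W.ψ_compl_re he]
  exact_mod_cast W.stepProb_le_one (isStarProjection_compl he) i

/-- If the trace vanished, then 𝓔(e ⊗ 1) = 0, and its value in the j-th state, which is ψ_j(e),
would vanish; this forces ψ_j(e^⊥) = 1. -/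
theorem normalizer_pos (hk : 1 ≤ k) (he : IsStarProjection e) {j : Λ}
    (hj : W.stepProb (1 - e) j < 1) : 0 < W.normalizer k e := by
  rw [pos_iff_ne_zero, normalizer, W.transition_one hk he]
  intro h0
  have h1 := eq_zero_of_posTrace_eq_zero (W.weighted_nonneg he fun _ => le_rfl) h0
  have h2 := W.blockState_weighted he (w := fun _ => 1) (fun _ => le_rfl) j
  have h3 : W.blockState j 0 = 0 := by simp [blockState, quadForm]
  rw [h1, h3, ← W.coe_stepProb he, ENNReal.coe_one, one_mul] at h2
  have h4 : W.stepProb e j = 0 := by exact_mod_cast h2.symm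
  have h5 := W.stepProb_add_compl he j
  rw [h4, zero_add] at h5
  exact hj.ne h5

end OQRW

end TreeQMC

end

/-! ### The main theorem -/

theorem mainTheorem5 {H K Λ : Type*} [NormedAddCommGroup H] [InnerProductSpace ℂ H]
    [CompleteSpace H] [TopologicalSpace.SeparableSpace H] [NormedAddCommGroup K]
    [InnerProductSpace ℂ K] [CompleteSpace K] [Countable Λ] (k : ℕ) (hk : 1 ≤ k)
    (W : TreeQMC.OQRW H K Λ)
    (e : TreeQMC.HTensor H K →L[ℂ] TreeQMC.HTensor H K) (he : IsStarProjection e)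
    (p : ℝ) (hp : p = ⨆ j, (W.ψ j (1 - e)).re) (hp1 : p < 1) :
    (∀ (r : TreeQMC.Ray k) (n : ℕ),
      0 ≤ W.condExp n (TreeQMC.tauInf e r n) ∧
        W.condExp n (TreeQMC.tauInf e r n) ≤ ((p ^ n : ℝ) : ℂ) • 1) ∧
    (∀ r : TreeQMC.Ray k,
      Tendsto (fun n => W.condExp n (TreeQMC.tauInf e r n)) atTop (𝓝 0)) ∧
    0 < W.normalizer k e ∧
    (W.normalizer k e < ∞ → W.IsRecurrent k e) := by
  have hle (j : Λ) : (W.stepProb (1 - e) j : ℝ) ≤ p := hp ▸ W.stepProb_compl_le he j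
  -- Some j exists because the total trace is 1; it yields 0 ≤ p and a sector witnessing a positive
  -- normalizer.
  obtain ⟨j₀⟩ := W.nonempty_index
  have hp0 : 0 ≤ p := (NNReal.coe_nonneg _).trans (hle j₀)
  have hq (n : ℕ) (j : Λ) : W.stepProb (1 - e) j ^ n ≤ 1 :=
    pow_le_one' (W.stepProb_le_one (TreeQMC.isStarProjection_compl he) j) n
  have hqp (n : ℕ) (j : Λ) : ((W.stepProb (1 - e) j ^ n : NNReal) : ℝ) ≤ p ^ n := by
    rw [NNReal.coe_pow]
    exact pow_le_pow_left₀ (NNReal.coe_nonneg _) (hle j) n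
  have hpos : 0 < W.normalizer k e :=
    W.normalizer_pos hk he (j := j₀) (by exact_mod_cast (hle j₀).trans_lt hp1)
  refine ⟨fun r n => ?_, fun r => ?_, hpos, fun hfin => ⟨hpos, hfin, fun r l => ?_⟩⟩
  · rw [W.condExp_tauInf hk he]
    exact ⟨W.weighted_nonneg (TreeQMC.isStarProjection_compl he) (hq n),
      W.weighted_le (TreeQMC.isStarProjection_compl he) (hq n) (by positivity) (hqp n)⟩
  · refine TreeQMC.tendsto_zero_of_norm_le_pow hp0 hp1 fun n => ?_
    rw [W.condExp_tauInf hk he]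
    exact W.norm_weighted_le (TreeQMC.isStarProjection_compl he) (hq n) (by positivity) (hqp n)
  -- The strong sum is 𝓔(e ⊗ 1) itself, so the ratio of traces is 1 once the trace is neither 0 nor
  -- ∞.
  · refine ⟨W.weighted e fun _ => 1, ?_, ?_⟩
    · simp_rw [W.condExp_rootTensor_tau hk he]
      exact W.hasSOTSum_weighted_geometric he hp0 hp1 hle
    · rw [← W.transition_one hk he]
      exact ENNReal.div_self hpos.ne' hfin.ne
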